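/- All asymptotics are as $n\to\infty$. For ${\bf d}=(d_1,\dots,d_n)\in\mathbb{Z}_{\ge 0}^n$ write $\|{\bf d}\|_1=\sum_{i} d_i$, $\Delta({\bf d})=\max_i d_i$, $\delta({\bf d})=\min_i d_i$, and let $P({\bf d})$ be the symmetric $n\times n$ matrix with $P({\bf d})_{jk}=\dfrac{d_jd_k}{\|{\bf d}\|_1+d_jd_k}$ for $j\ne k$ and $P({\bf d})_{jj}=0$. If $\|{\bf d}\|_1$ is even, $\mathcal G(n,{\bf d})$ denotes a uniformly random simple graph on $[n]$ in which each vertex $i$ has degree $d_i$. For a symmetric matrix $W\in[0,1]^{n\times n}$, $\mathcal G(n,W)$ denotes the random graph on $[n]$ in which each pair $jk$ with $j\neq k$ is an edge with probability $W_{jk}$, independently of the other pairs. **Theorem.** For each $n$ let ${\bf d}={\bf d}(n)\in\mathbb{Z}_{\ge0}^n$ be a sequence with $\|{\bf d}\|_1$ even, and suppose that $$\Delta({\bf d})^2=o(\|{\bf d}\|_1)\qquad\text{and}\qquad \log n=o(\delta({\bf d})).$$ Then there are symmetric matrices $W=W(n)\in[0,1]^{n\times n}$ (for all sufficiently large $n$)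 with $W=(1-o(1))P({\bf d})$, that is, for some $\varepsilon_n\to0$, $$(1-\varepsilon_n)P({\bf d})_{jk}\le W_{jk}\le P({\bf d})_{jk}\qquad\text{for all } j,k\in[n],$$ and a coupling $(G_L,G)$ (two random graphs on a common probability space) with $G_L\sim\mathcal G(n,W)$ and $G\sim\mathcal G(n,{\bf d})$, such that $$\mathbb P(G_L\subseteq G)=1-o(1).$$ In particular, graphs with degree sequence ${\bf d}(n)$ exist for all sufficiently large $n$. Moreover this embedding is optimal in the sense that $P({\bf d})$ is asymptotic to the matrix of true edge probabilities: for some $\eta_n\to0$ and all sufficiently large $n$, $$\bigl|\mathbb P(jk\in\mathcal G(n,{\bf d}))-P({\bf d})_{jk}\bigr|\le\eta_n\,P({\bf d})_{jk}\qquad\text{for all } j\ne k.$$ -/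

import Mathlib

open MeasureTheory Filter Topology

namespace RandomGraphEmbedding

variable {n : ℕ}

/-- The `ℓ¹`-norm `‖d‖₁ = d₁ + ⋯ + dₙ` of a sequence of natural numbers. -/
def total (d : Fin n → ℕ) : ℕ := ∑ i, d i

/-- The maximum degree `Δ(d)`. -/
def maxDeg (d : Fin n → ℕ) : ℕ := Finset.univ.sup d

/-- The minimum degree `δ(d)` (with the value `0` when `n = 0`). -/
noncomputable def minDeg (d : Fin n → ℕ) : ℕ := ⨅ i, d i

/-- The symmetric matrix `P(d)`, with `P(d)ⱼₖ = dⱼ dₖ / (‖d‖₁ + dⱼ dₖ)` for `j ≠ k` and zeros on the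
diagonal. -/
noncomputable def edgeMatrix (d : Fin n → ℕ) : Matrix (Fin n) (Fin n) ℝ :=
  Matrix.of fun j k =>
    if j = k then 0 else (d j * d k : ℝ) / ((total d : ℝ) + d j * d k)

open Classical in
/-- The probability that the random graph on `Fin n` in which every pair `j < k` is an edge
independently with probability `W j k` equals the graph `G`. -/
noncomputable def inhomogeneousWeight (W : Matrix (Fin n) (Fin n) ℝ)
    (G : SimpleGraph (Fin n)) : ℝ :=
  ∏ j : Fin n, ∏ k ∈ Finset.Ioi j, if G.Adj j k then W j k else 1 - W j k

/-- The law of `𝒢(n, W)`, for a symmetric matrix `W` with entries in `[0, 1]`: each pair `jk` is an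
edge with probability `W j k`, independently of the other pairs. -/
noncomputable def inhomogeneousGraph (W : Matrix (Fin n) (Fin n) ℝ) :
    Measure (SimpleGraph (Fin n)) :=
  Measure.sum fun G => ENNReal.ofReal (inhomogeneousWeight W G) • Measure.dirac G

/-- The graphs on `Fin n` in which each vertex `i` has degree `d i`. -/
def graphsWithDegrees (d : Fin n → ℕ) : Set (SimpleGraph (Fin n)) :=
  {G | ∀ i, (G.neighborSet i).ncard = d i}

/-- The law of `𝒢(n, d)`: the uniform probability measure on the graphs with degree sequence `d`
(it is the zero measure if there is no such graph). -/
noncomputable def degreeGraph (d : Fin n → ℕ) : Measure (SimpleGraph (Fin n)) :=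
  ProbabilityTheory.uniformOn (graphsWithDegrees d)

/-- `μ` is (the joint law of) a coupling of `ν₁` and `ν₂`: on the probability space `(α × β, μ)` the
two coordinates have laws `ν₁` and `ν₂`. -/
structure IsCoupling {α β : Type*} [MeasurableSpace α] [MeasurableSpace β]
    (μ : Measure (α × β)) (ν₁ : Measure α) (ν₂ : Measure β) : Prop where
  isProbabilityMeasure : IsProbabilityMeasure μ
  map_fst : μ.map Prod.fst = ν₁
  map_snd : μ.map Prod.snd = ν₂

end RandomGraphEmbedding

/-!
By an approximate form of Strassen's theorem, the coupling exists as soon as, for monotone `f` with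
values in `[0, 1]`, the mean of `f` on `𝒢(n, W)` exceeds its mean on `𝒢(n, d)` by at most `o(1)`.
To compare the two means, interpolate: let `G` be a uniform member of the family `𝒞` of graphs with
degrees `d`, let `H` retain each edge of `G` with probability `t`, and let `R` contain each pair `e`
independently with probability `1 - exp (-θ e * (τ - t))`. At `t = 0` the union `H ∪ R` is the
inhomogeneous random graph, and at `t = τ` it is contained in `G`. The `t`-derivative of the mean of
`f (H ∪ R)` is nonnegative up to a small error as soon as, given a typical `H`, every pair `e ∉ H`
is an edge of `G` with probability at least `(1 - t) * θ e`. With `θ = (1 - o(1)) d j * d k / ‖d‖₁`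
this holds by switching edges of `G` outside `H`, provided that the degrees of `H` are close to
`t * d v`; by Chernoff's inequality and a union bound over the vertices, which is where
`log n = o(δ(d))` enters, all degrees of `H` are typical with high probability. The same switchings
at `t = 0` give the edge probabilities of `𝒢(n, d)`.
-/

namespace RandomGraphEmbedding

section Strassen

variable {X Y : Type*} [Fintype X] [Fintype Y]

/-- The transport plans with source `μ` that only move mass upwards. -/
def upwardPlans [LE X] (μ : X → ℝ) : Set (X → X → ℝ) :=
  {π | (∀ x y, 0 ≤ π x y) ∧ (∀ x, ∑ y, π x y = μ x) ∧ ∀ x y, ¬ x ≤ y → π x y = 0}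

theorem upwardPlans_nonempty [Preorder X] {μ : X → ℝ} (hμ : ∀ x, 0 ≤ μ x) :
    (upwardPlans μ).Nonempty := by
  classical
  refine ⟨fun x => Pi.single x (μ x), fun x y => ?_, fun x => Fintype.sum_pi_single' x (μ x),
    fun x y hxy => Pi.single_eq_of_ne (fun hyx => hxy hyx.ge) _⟩
  exact (Pi.single_nonneg.2 (hμ x) : (0 : X → ℝ) ≤ Pi.single x (μ x)) y

theorem isCompact_upwardPlans [LE X] (μ : X → ℝ) : IsCompact (upwardPlans μ) := by
  have hsub : upwardPlans μ ⊆ Set.Icc 0 fun x _ => μ x := fun π hπ =>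
    ⟨hπ.1, fun x y => (Finset.single_le_sum (fun z _ => hπ.1 x z) (Finset.mem_univ y)).trans_eq
      (hπ.2.1 x)⟩
  refine isCompact_Icc.of_isClosed_subset ?_ hsub
  simp only [upwardPlans, Set.ofPred_and, Set.ofPred_forall]
  refine .inter ?_ (.inter ?_ ?_)
  · exact isClosed_iInter fun x => isClosed_iInter fun y =>
      isClosed_le continuous_const (by fun_prop)
  · exact isClosed_iInter fun x => isClosed_eq (by fun_prop) continuous_const
  · exact isClosed_iInter fun x => isClosed_iInter fun y => isClosed_iInter fun _ =>
      isClosed_eq (by fun_prop) continuous_const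

theorem add_single_mem_upwardPlans [Preorder X] [DecidableEq X] {μ : X → ℝ} {π : X → X → ℝ}
    (hπ : π ∈ upwardPlans μ) {x y y' : X} {s : ℝ} (hs : 0 ≤ s) (hsπ : s ≤ π x y) (hxy : x ≤ y)
    (hxy' : x ≤ y') :
    π + Pi.single x (Pi.single y' s - Pi.single y s) ∈ upwardPlans μ := by
  obtain ⟨h_nonneg, h_row, h_support⟩ := hπ
  refine ⟨fun a b => ?_, fun a => ?_, fun a b hab => ?_⟩ <;>
    rcases eq_or_ne a x with rfl | hax
  · have hy' : 0 ≤ (Pi.single y' s : X → ℝ) b :=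
      (Pi.single_nonneg.2 hs : (0 : X → ℝ) ≤ Pi.single y' s) b
    rcases eq_or_ne b y with rfl | hby
    · simpa using by linarith
    · simpa [hby] using add_nonneg (h_nonneg a b) hy'
  · simpa [hax] using h_nonneg a b
  · simp [Finset.sum_add_distrib, h_row]
  · simp [hax, h_row]
  · have hby : b ≠ y := fun h => hab (h ▸ hxy)
    have hby' : b ≠ y' := fun h => hab (h ▸ hxy')
    simp [hby, hby', h_support a b hab]
  · simp [hax, h_support a b hab]

theorem sum_sq_add_single_sub_single [DecidableEq X] (e : X → ℝ) {y y' : X} (hne : y ≠ y')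
    (s : ℝ) :
    ∑ b, (e b + (Pi.single y' s - Pi.single y s : X → ℝ) b) ^ 2 =
      ∑ b, e b ^ 2 + 2 * s * (e y' - e y) + 2 * s ^ 2 := by
  have hterm : ∀ b, (e b + (Pi.single y' s - Pi.single y s : X → ℝ) b) ^ 2 =
      e b ^ 2 + (if b = y' then 2 * s * e b + s ^ 2 else 0) +
        if b = y then -(2 * s * e b) + s ^ 2 else 0 := by
    intro b
    simp only [Pi.sub_apply, Pi.single_apply]
    split_ifs with hy' hy
    · exact absurd (hy.symm.trans hy') hne
    all_goals ring
  simp only [hterm, Finset.sum_add_distrib, Finset.sum_ite_eq', Finset.mem_univ, if_true]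
  ring

/-- A minimizer of `∑ y, (∑ z, π z y - ν y) ^ 2` works, as moving mass from an admissible target to
another one of smaller excess would decrease this sum. -/
theorem exists_balanced_upwardPlan [Preorder X] {μ : X → ℝ} (hμ : ∀ x, 0 ≤ μ x) (ν : X → ℝ) :
    ∃ π ∈ upwardPlans μ, ∀ x y y', 0 < π x y → x ≤ y' →
      ∑ z, π z y - ν y ≤ ∑ z, π z y' - ν y' := by
  classical
  obtain ⟨π, hπ, hmin⟩ := (isCompact_upwardPlans μ).exists_isMinOn (upwardPlans_nonempty hμ)
    (f := fun π : X → X → ℝ => ∑ y, (∑ z, π z y - ν y) ^ 2) (by fun_prop)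
  refine ⟨π, hπ, fun x y y' hxy hxy' => ?_⟩
  by_contra! hlt
  have hne : y ≠ y' := by rintro rfl; exact lt_irrefl _ hlt
  have hle : x ≤ y := not_not.1 fun h => hxy.ne' (hπ.2.2 x y h)
  set e : X → ℝ := fun y => ∑ z, π z y - ν y
  change e y' < e y at hlt
  set s : ℝ := min (π x y) ((e y - e y') / 2)
  have hs : 0 < s := lt_min hxy (by linarith)
  have hse : s ≤ (e y - e y') / 2 := min_le_right _ _
  have hcol : ∀ b, ∑ z, (π + Pi.single x (Pi.single y' s - Pi.single y s) : X → X → ℝ) z b - ν b =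
      e b + (Pi.single y' s - Pi.single y s : X → ℝ) b := by
    intro b
    have hsingle : ∑ z, (Pi.single x (Pi.single y' s - Pi.single y s) : X → X → ℝ) z b =
        (Pi.single y' s - Pi.single y s : X → ℝ) b := by
      rw [← Finset.sum_apply, Fintype.sum_pi_single']
    simp only [Pi.add_apply, Finset.sum_add_distrib, hsingle, e]
    ring
  have hdecrease := hmin (add_single_mem_upwardPlans hπ hs.le (min_le_left _ _) hle hxy')
  simp only [Set.mem_ofPred_eq, hcol, sum_sq_add_single_sub_single e hne] at hdecrease
  nlinarith

theorem sum_le_sum_min_add_of_balanced [Preorder X] {μ ν : X → ℝ} {π : X → X → ℝ}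
    (hμ : ∀ x, 0 ≤ μ x) (hν : ∀ x, 0 ≤ ν x) (hπ : π ∈ upwardPlans μ)
    (hbal : ∀ x y y', 0 < π x y → x ≤ y' → ∑ z, π z y - ν y ≤ ∑ z, π z y' - ν y') {ε : ℝ}
    (h : ∀ U : Finset X, IsUpperSet (U : Set X) → ∑ x ∈ U, μ x ≤ ∑ x ∈ U, ν x + ε) :
    ∑ x, μ x ≤ ∑ y, min (∑ x, π x y) (ν y) + ε := by
  classical
  set ρ : X → ℝ := fun y => ∑ x, π x y with hρ
  let V : Finset X := {y | 0 < ρ y - ν y}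
  let S : Finset X := {x | ∃ y ∈ V, 0 < π x y}
  let U : Finset X := {y | ∃ x ∈ S, x ≤ y}
  have hSU : S ⊆ U := fun x hx => by simpa [U] using ⟨x, hx, le_rfl⟩
  have hUV : U ⊆ V := by
    intro y' hy'
    obtain ⟨x, hxS, hxy'⟩ := (Finset.mem_filter.1 hy').2
    obtain ⟨y, hyV, hxy⟩ := (Finset.mem_filter.1 hxS).2
    simpa [V] using (Finset.mem_filter.1 hyV).2.trans_le (hbal x y y' hxy hxy')
  have hU : IsUpperSet (U : Set X) := by
    intro a b hab ha
    obtain ⟨x, hxS, hxa⟩ := (Finset.mem_filter.1 ha).2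
    simpa [U] using ⟨x, hxS, hxa.trans hab⟩
  have hVS : ∑ y ∈ V, ρ y ≤ ∑ x ∈ S, μ x := by
    rw [hρ, Finset.sum_comm, ← Finset.sum_subset (Finset.subset_univ S)]
    · exact Finset.sum_le_sum fun x _ => hπ.2.1 x ▸
        Finset.sum_le_sum_of_subset_of_nonneg (Finset.subset_univ V) fun y _ _ => hπ.1 x y
    · intro x _ hxS
      refine Finset.sum_eq_zero fun y hyV => (hπ.1 x y).antisymm' (not_lt.1 fun hxy => hxS ?_)
      simpa [S] using ⟨y, hyV, hxy⟩
  have hexcess : ∑ y, ρ y - ∑ y, min (ρ y) (ν y) = ∑ y ∈ V, ρ y - ∑ y ∈ V, ν y := by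
    rw [← Finset.sum_sub_distrib, ← Finset.sum_sub_distrib, Finset.sum_filter]
    refine Finset.sum_congr rfl fun y _ => ?_
    split_ifs with hy
    · rw [min_eq_right (by linarith)]
    · rw [min_eq_left (by linarith), sub_self]
  have hmass : ∑ y, ρ y = ∑ x, μ x := by
    rw [hρ, Finset.sum_comm]
    exact Finset.sum_congr rfl fun x _ => hπ.2.1 x
  have hSUμ := Finset.sum_le_sum_of_subset_of_nonneg hSU fun x _ _ => hμ x
  have hUVν := Finset.sum_le_sum_of_subset_of_nonneg hUV fun x _ _ => hν x
  linarith [h U hU]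

theorem exists_coupling_ge_of_marginals_le {K : X → Y → ℝ} {μ : X → ℝ} {ν : Y → ℝ}
    (hrow : ∀ x, ∑ y, K x y ≤ μ x) (hcol : ∀ y, ∑ x, K x y ≤ ν y) (hmass : ∑ x, μ x = ∑ y, ν y) :
    ∃ J : X → Y → ℝ, (∀ x y, K x y ≤ J x y) ∧ (∀ x, ∑ y, J x y = μ x) ∧
      ∀ y, ∑ x, J x y = ν y := by
  set f : X → ℝ := fun x => μ x - ∑ y, K x y with hf_def
  set g : Y → ℝ := fun y => ν y - ∑ x, K x y with hg_def
  have hf : ∀ x, 0 ≤ f x := fun x => sub_nonneg.2 (hrow x)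
  have hg : ∀ y, 0 ≤ g y := fun y => sub_nonneg.2 (hcol y)
  have hfg : ∑ x, f x = ∑ y, g y := by
    simp only [hf_def, hg_def, Finset.sum_sub_distrib, hmass]
    rw [Finset.sum_comm]
  have hle_f : ∀ x, f x ≤ ∑ x, f x := fun x =>
    Finset.single_le_sum (fun x _ => hf x) (Finset.mem_univ x)
  have hle_g : ∀ y, g y ≤ ∑ y, g y := fun y =>
    Finset.single_le_sum (fun y _ => hg y) (Finset.mem_univ y)
  refine ⟨fun x y => K x y + f x * g y / ∑ y, g y, fun x y => ?_, fun x => ?_, fun y => ?_⟩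
  · exact le_add_of_nonneg_right
      (div_nonneg (mul_nonneg (hf x) (hg y)) (Finset.sum_nonneg fun y _ => hg y))
  · have hfx : f x * (∑ y, g y) / ∑ y, g y = f x := mul_div_cancel_of_imp fun h0 =>
      ((hle_f x).trans (hfg.trans h0).le).antisymm (hf x)
    rw [Finset.sum_add_distrib, ← Finset.sum_div, ← Finset.mul_sum, hfx, hf_def]
    ring
  · have hgy : (∑ x, f x) * g y / ∑ y, g y = g y := by
      rw [hfg, mul_comm]
      exact mul_div_cancel_of_imp fun h0 => ((hle_g y).trans h0.le).antisymm (hg y)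
    rw [Finset.sum_add_distrib, ← Finset.sum_div, ← Finset.sum_mul, hgy, hg_def]
    ring

/-- Rescaling the columns of a balanced plan down to the capacities `ν` loses mass at most `ε`. -/
theorem exists_coupling_of_sum_upperSet_le [Preorder X] [DecidableLE X] {μ ν : X → ℝ}
    (hμ : ∀ x, 0 ≤ μ x) (hν : ∀ x, 0 ≤ ν x) (hmass : ∑ x, μ x = ∑ x, ν x) {ε : ℝ}
    (h : ∀ U : Finset X, IsUpperSet (U : Set X) → ∑ x ∈ U, μ x ≤ ∑ x ∈ U, ν x + ε) :
    ∃ J : X → X → ℝ, (∀ x y, 0 ≤ J x y) ∧ (∀ x, ∑ y, J x y = μ x) ∧ (∀ y, ∑ x, J x y = ν y) ∧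
      ∑ x, μ x - ε ≤ ∑ p : X × X with p.1 ≤ p.2, J p.1 p.2 := by
  obtain ⟨π, hπ, hbal⟩ := exists_balanced_upwardPlan hμ ν
  have hloss := sum_le_sum_min_add_of_balanced hμ hν hπ hbal h
  set ρ : X → ℝ := fun y => ∑ x, π x y
  have hρ : ∀ y, 0 ≤ ρ y := fun y => Finset.sum_nonneg fun x _ => hπ.1 x y
  let K : X → X → ℝ := fun x y => π x y * (min (ρ y) (ν y) / ρ y)
  have hK : ∀ x y, 0 ≤ K x y := fun x y =>
    mul_nonneg (hπ.1 x y) (div_nonneg (le_min (hρ y) (hν y)) (hρ y))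
  have hK_row : ∀ x, ∑ y, K x y ≤ μ x := fun x => hπ.2.1 x ▸ Finset.sum_le_sum fun y _ =>
    mul_le_of_le_one_right (hπ.1 x y) (div_le_one_of_le₀ (min_le_left _ _) (hρ y))
  have hK_col : ∀ y, ∑ x, K x y = min (ρ y) (ν y) := fun y => by
    rw [← Finset.sum_mul, mul_div_cancel_of_imp' fun h0 => ?_]
    exact (congrArg (min · (ν y)) h0).trans (min_eq_left (hν y))
  obtain ⟨J, hKJ, hJ_row, hJ_col⟩ := exists_coupling_ge_of_marginals_le hK_row
    (fun y => (hK_col y).trans_le (min_le_right _ _)) hmass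
  refine ⟨J, fun x y => (hK x y).trans (hKJ x y), hJ_row, hJ_col, ?_⟩
  calc ∑ x, μ x - ε ≤ ∑ y, ∑ x, K x y := by
        simp only [hK_col]
        linarith
    _ = ∑ p : X × X, K p.1 p.2 := by rw [Finset.sum_comm, Fintype.sum_prod_type]
    _ = ∑ p : X × X with p.1 ≤ p.2, K p.1 p.2 := by
        refine (Finset.sum_filter_of_ne fun p _ hp => not_not.1 fun hle => hp ?_).symm
        simp only [K, hπ.2.2 p.1 p.2 hle, zero_mul]
    _ ≤ ∑ p : X × X with p.1 ≤ p.2, J p.1 p.2 := Finset.sum_le_sum fun p _ => hKJ p.1 p.2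

end Strassen

section ProductMeasure

variable {α : Type*} [DecidableEq α] [Fintype α]

/-- The probability that the random subset containing each `e` independently with probability
`p e` equals `R`. -/
def productWeight (p : α → ℝ) (R : Finset α) : ℝ :=
  ∏ e, if e ∈ R then p e else 1 - p e

/-- The expectation of `f` at the random subset containing each `e` independently with probability
`p e`. -/
def productMean (p : α → ℝ) (f : Finset α → ℝ) : ℝ :=
  ∑ R, productWeight p R * f R

/-- `productWeight` with the factor of `e` left out. -/
def productWeightErase (p : α → ℝ) (e : α) (R : Finset α) : ℝ :=
  ∏ a ∈ Finset.univ.erase e, if a ∈ R then p a else 1 - p a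

/-- The derivative of `productWeight p R` when each `p e` has derivative `c e * (1 - p e)`. -/
def productWeightDeriv (p c : α → ℝ) (R : Finset α) : ℝ :=
  ∑ e, productWeightErase p e R * if e ∈ R then c e * (1 - p e) else -(c e * (1 - p e))

theorem productWeight_nonneg {p : α → ℝ} (h0 : ∀ e, 0 ≤ p e) (h1 : ∀ e, p e ≤ 1) (R : Finset α) :
    0 ≤ productWeight p R := by
  refine Finset.prod_nonneg fun e _ => ?_
  split_ifs
  exacts [h0 e, sub_nonneg.2 (h1 e)]

theorem productWeight_eq_zero {p : α → ℝ} {R : Finset α} {e : α} (he : e ∈ R) (h : p e = 0) :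
    productWeight p R = 0 :=
  Finset.prod_eq_zero (Finset.mem_univ e) (by simp [he, h])

theorem productMean_prod (p x : α → ℝ) :
    (productMean p fun R => ∏ e ∈ R, x e) = ∏ e, (p e * x e + (1 - p e)) := by
  rw [Fintype.prod_add, productMean]
  refine Finset.sum_congr rfl fun R _ => ?_
  have hcompl : Finset.univ.filter (fun e => e ∉ R) = Rᶜ := by ext; simp
  rw [productWeight, Finset.prod_ite, Finset.filter_mem_eq_inter, Finset.univ_inter,
    Finset.prod_mul_distrib, hcompl]
  ring

theorem sum_productWeight (p : α → ℝ) : ∑ R, productWeight p R = 1 := by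
  simpa [productMean] using productMean_prod p fun _ => 1

theorem productMean_const (p : α → ℝ) (a : ℝ) : (productMean p fun _ => a) = a := by
  rw [productMean, ← Finset.sum_mul, sum_productWeight, one_mul]

theorem productMean_mono {p : α → ℝ} (h0 : ∀ e, 0 ≤ p e) (h1 : ∀ e, p e ≤ 1)
    {f g : Finset α → ℝ} (hfg : ∀ R, f R ≤ g R) : productMean p f ≤ productMean p g :=
  Finset.sum_le_sum fun R _ => mul_le_mul_of_nonneg_left (hfg R) (productWeight_nonneg h0 h1 R)

theorem productMean_mem_Icc {p : α → ℝ} (h0 : ∀ e, 0 ≤ p e) (h1 : ∀ e, p e ≤ 1)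
    {f : Finset α → ℝ} {a b : ℝ} (hf : ∀ R, f R ∈ Set.Icc a b) :
    productMean p f ∈ Set.Icc a b :=
  ⟨(productMean_const p a).symm.trans_le (productMean_mono h0 h1 fun R => (hf R).1),
    (productMean_mono h0 h1 fun R => (hf R).2).trans_eq (productMean_const p b)⟩

theorem productMean_zero (f : Finset α → ℝ) : productMean 0 f = f ∅ := by
  rw [productMean, Finset.sum_eq_single ∅]
  · simp [productWeight]
  · intro R _ hR
    obtain ⟨e, he⟩ := Finset.nonempty_iff_ne_empty.2 hR
    rw [productWeight_eq_zero he rfl, zero_mul]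
  · simp

theorem productWeight_eq_mul_erase (p : α → ℝ) (e : α) (R : Finset α) :
    productWeight p R = (if e ∈ R then p e else 1 - p e) * productWeightErase p e R :=
  (Finset.mul_prod_erase Finset.univ (fun a => if a ∈ R then p a else 1 - p a)
    (Finset.mem_univ e)).symm

theorem productWeightErase_insert (p : α → ℝ) (e : α) (R : Finset α) :
    productWeightErase p e (insert e R) = productWeightErase p e R :=
  Finset.prod_congr rfl fun a ha => by simp [Finset.ne_of_mem_erase ha]

theorem sum_eq_sum_filter_notMem_add (e : α) (F : Finset α → ℝ) :
    ∑ R, F R = ∑ R with e ∉ R, (F R + F (insert e R)) := by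
  rw [Finset.sum_add_distrib, ← Finset.sum_filter_add_sum_filter_not Finset.univ (fun R => e ∉ R)]
  congr 1
  refine Finset.sum_nbij' (fun R => R.erase e) (insert e) ?_ ?_ ?_ ?_ ?_ <;>
    simp +contextual [Finset.insert_erase]

theorem hasDerivAt_productWeight {p : ℝ → α → ℝ} {c : α → ℝ} {t : ℝ}
    (h : ∀ e, HasDerivAt (fun s => p s e) (c e * (1 - p t e)) t) (R : Finset α) :
    HasDerivAt (fun s => productWeight (p s) R) (productWeightDeriv (p t) c R) t := by
  have hfactor : ∀ e ∈ Finset.univ, HasDerivAt (fun s => if e ∈ R then p s e else 1 - p s e)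
      (if e ∈ R then c e * (1 - p t e) else -(c e * (1 - p t e))) t := by
    intro e _
    split_ifs
    exacts [h e, (h e).const_sub 1]
  simpa only [productWeight, productWeightDeriv, productWeightErase, smul_eq_mul] using
    HasDerivAt.fun_finsetProd hfactor

theorem sum_productWeightDeriv_mul (p c : α → ℝ) (f : Finset α → ℝ) :
    ∑ R, productWeightDeriv p c R * f R =
      ∑ e, c e * productMean p fun R => f (insert e R) - f R := by
  simp only [productWeightDeriv, Finset.sum_mul]
  rw [Finset.sum_comm]
  refine Finset.sum_congr rfl fun e _ => ?_
  rw [productMean, sum_eq_sum_filter_notMem_add e, sum_eq_sum_filter_notMem_add e, Finset.mul_sum]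
  refine Finset.sum_congr rfl fun R hR => ?_
  rw [productWeight_eq_mul_erase p e R]
  simp only [(Finset.mem_filter.1 hR).2, productWeightErase_insert, Finset.mem_insert_self, if_true,
    if_false, Finset.insert_idem, sub_self, mul_zero, add_zero]
  ring

/-- Russo's formula, for an integrand that may depend on the parameter as well. -/
theorem hasDerivAt_productMean {p : ℝ → α → ℝ} {c : α → ℝ} {t : ℝ}
    (hp : ∀ e, HasDerivAt (fun s => p s e) (c e * (1 - p t e)) t)
    {f : ℝ → Finset α → ℝ} {f' : Finset α → ℝ}
    (hf : ∀ R, HasDerivAt (fun s => f s R) (f' R) t) :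
    HasDerivAt (fun s => productMean (p s) (f s))
      ((∑ e, c e * productMean (p t) fun R => f t (insert e R) - f t R) +
        productMean (p t) f') t := by
  rw [← sum_productWeightDeriv_mul, productMean, ← Finset.sum_add_distrib]
  exact HasDerivAt.fun_sum fun R _ => (hasDerivAt_productWeight hp R).fun_mul (hf R)

theorem hasDerivAt_productMean_union {p q : ℝ → α → ℝ} {c c' : α → ℝ} {t : ℝ}
    (hp : ∀ e, HasDerivAt (fun s => p s e) (c e * (1 - p t e)) t)
    (hq : ∀ e, HasDerivAt (fun s => q s e) (c' e * (1 - q t e)) t) (f : Finset α → ℝ) :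
    HasDerivAt (fun s => productMean (p s) fun H => productMean (q s) fun R => f (H ∪ R))
      (∑ H, ∑ e, productWeight (p t) H * (c e + c' e) *
        productMean (q t) fun R => f (insert e (H ∪ R)) - f (H ∪ R)) t := by
  have hinner := fun H => hasDerivAt_productMean hq (f := fun _ R => f (H ∪ R)) (f' := 0)
    fun R => hasDerivAt_const t (f (H ∪ R))
  refine (hasDerivAt_productMean hp hinner).congr_deriv ?_
  rw [Finset.sum_comm]
  simp only [productMean, Finset.mul_sum, Finset.sum_add_distrib, mul_add, add_mul, mul_sub,
    Finset.sum_sub_distrib, Pi.zero_apply, mul_zero, Finset.sum_const_zero, add_zero,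
    Finset.insert_union, Finset.union_insert]
  have hswap : ∀ g : α → Finset α → Finset α → ℝ,
      ∑ H, ∑ e, ∑ R, g e H R = ∑ e, ∑ H, ∑ R, g e H R := fun g => Finset.sum_comm
  rw [hswap, hswap]
  simp only [mul_assoc, mul_left_comm (c _)]
  ring

end ProductMeasure

section Thinning

variable {α : Type*} [DecidableEq α]

/-- The probabilities with which each `e` belongs to the `t`-thinning of `G`, which retains the
elements of `G` independently with probability `t`. -/
def thinning (t : ℝ) (G : Finset α) (e : α) : ℝ := if e ∈ G then t else 0

/-- The number of members of `𝒞` that contain `H`. -/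
def extCount (𝒞 : Finset (Finset α)) (H : Finset α) : ℕ := (𝒞.filter fun G => H ⊆ G).card

theorem thinning_nonneg {t : ℝ} (ht : 0 ≤ t) (G : Finset α) (e : α) : 0 ≤ thinning t G e := by
  unfold thinning; split_ifs <;> simp [ht]

theorem thinning_le_one {t : ℝ} (ht : t ≤ 1) (G : Finset α) (e : α) : thinning t G e ≤ 1 := by
  unfold thinning; split_ifs <;> simp [ht]

theorem hasDerivAt_thinning (G : Finset α) (e : α) {t : ℝ} (ht : t < 1) :
    HasDerivAt (fun s => thinning s G e)
      ((if e ∈ G then (1 - t)⁻¹ else 0) * (1 - thinning t G e)) t := by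
  unfold thinning
  split_ifs
  · rw [inv_mul_cancel₀ (sub_pos.2 ht).ne']
    exact hasDerivAt_id' t
  · rw [zero_mul]
    exact hasDerivAt_const t 0

variable [Fintype α]

theorem productWeight_thinning_nonneg {t : ℝ} (ht0 : 0 ≤ t) (ht1 : t ≤ 1) (G H : Finset α) :
    0 ≤ productWeight (thinning t G) H :=
  productWeight_nonneg (thinning_nonneg ht0 G) (thinning_le_one ht1 G) H

theorem productWeight_thinning (t : ℝ) (G H : Finset α) :
    productWeight (thinning t G) H =
      if H ⊆ G then t ^ H.card * (1 - t) ^ (G.card - H.card) else 0 := by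
  split_ifs with hHG
  · have hfactor : ∀ e, (if e ∈ H then thinning t G e else 1 - thinning t G e) =
        (if e ∈ H then t else 1) * (if e ∈ G \ H then 1 - t else 1) := by
      intro e
      by_cases heH : e ∈ H
      · simp [heH, thinning, hHG heH]
      · by_cases heG : e ∈ G <;> simp [heH, heG, thinning]
    rw [productWeight, Finset.prod_congr rfl fun e _ => hfactor e, Finset.prod_mul_distrib,
      Finset.prod_ite_mem, Finset.prod_ite_mem, Finset.univ_inter, Finset.univ_inter,
      Finset.prod_const, Finset.prod_const, Finset.card_sdiff_of_subset hHG]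
  · obtain ⟨e, heH, heG⟩ := Finset.not_subset.1 hHG
    exact productWeight_eq_zero heH (by simp [thinning, heG])

theorem sum_productWeight_thinning_mul {𝒞 : Finset (Finset α)} {m : ℕ}
    (hm : (𝒞 : Set (Finset α)).Sized m) (t : ℝ) (H : Finset α) (e : α) (a b : ℝ) :
    ∑ G ∈ 𝒞, productWeight (thinning t G) H * ((if e ∈ G then a else 0) - b) =
      t ^ H.card * (1 - t) ^ (m - H.card) *
        (a * extCount 𝒞 (insert e H) - b * extCount 𝒞 H) := by
  have hterm : ∀ G ∈ 𝒞, productWeight (thinning t G) H * ((if e ∈ G then a else 0) - b) =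
      t ^ H.card * (1 - t) ^ (m - H.card) *
        (a * (if insert e H ⊆ G then 1 else 0) - b * if H ⊆ G then 1 else 0) := by
    intro G hG
    rw [productWeight_thinning, hm hG]
    by_cases hH : H ⊆ G <;> by_cases he : e ∈ G <;> simp [hH, he, Finset.insert_subset_iff]
  rw [Finset.sum_congr rfl hterm, ← Finset.mul_sum, Finset.sum_sub_distrib, ← Finset.mul_sum,
    ← Finset.mul_sum]
  simp only [extCount, Finset.sum_boole]

end Thinning

section Interpolation

variable {α : Type*} [DecidableEq α] [Fintype α]

/-- The probability that a Poisson process of rate `r` has a point in a time interval of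
length `s`. -/
noncomputable def arrivalProb (r s : ℝ) : ℝ := 1 - Real.exp (-(r * s))

/-- The sum over `G ∈ 𝒞` of the expectation of `f (H ∪ R)`, where `H` is the `t`-thinning of `G` and
`R` is the set of the elements that arrive at rates `θ` in the remaining time `τ - t`. -/
noncomputable def interpolation (𝒞 : Finset (Finset α)) (θ : α → ℝ) (τ : ℝ) (f : Finset α → ℝ)
    (t : ℝ) : ℝ :=
  ∑ G ∈ 𝒞, productMean (thinning t G) fun H =>
    productMean (fun e => arrivalProb (θ e) (τ - t)) fun R => f (H ∪ R)

theorem arrivalProb_nonneg {r s : ℝ} (hr : 0 ≤ r) (hs : 0 ≤ s) : 0 ≤ arrivalProb r s := by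
  simpa [arrivalProb] using mul_nonneg hr hs

theorem arrivalProb_le_one (r s : ℝ) : arrivalProb r s ≤ 1 :=
  sub_le_self 1 (Real.exp_pos _).le

theorem hasDerivAt_arrivalProb_sub (r τ t : ℝ) :
    HasDerivAt (fun s => arrivalProb r (τ - s)) (-r * (1 - arrivalProb r (τ - t))) t := by
  have hexponent : HasDerivAt (fun s => -(r * (τ - s))) r t := by
    simpa using (((hasDerivAt_id' t).const_sub τ).const_mul r).fun_neg
  refine (hexponent.exp.const_sub 1).congr_deriv ?_
  simp only [arrivalProb]
  ring

theorem hasDerivAt_interpolation (𝒞 : Finset (Finset α)) (θ : α → ℝ) (τ : ℝ) (f : Finset α → ℝ)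
    {t : ℝ} (ht : t < 1) :
    HasDerivAt (interpolation 𝒞 θ τ f)
      (∑ H, ∑ e, (∑ G ∈ 𝒞, productWeight (thinning t G) H *
          ((if e ∈ G then (1 - t)⁻¹ else 0) - θ e)) *
        productMean (fun e => arrivalProb (θ e) (τ - t))
          fun R => f (insert e (H ∪ R)) - f (H ∪ R)) t := by
  refine (HasDerivAt.fun_sum fun G (_ : G ∈ 𝒞) =>
    hasDerivAt_productMean_union (fun e => hasDerivAt_thinning G e ht)
      (fun e => hasDerivAt_arrivalProb_sub (θ e) τ t) f).congr_deriv ?_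
  rw [Finset.sum_comm]
  refine Finset.sum_congr rfl fun H _ => ?_
  rw [Finset.sum_comm]
  simp only [← sub_eq_add_neg, Finset.sum_mul]

theorem interpolation_zero (𝒞 : Finset (Finset α)) (θ : α → ℝ) (τ : ℝ) (f : Finset α → ℝ) :
    interpolation 𝒞 θ τ f 0 = 𝒞.card * productMean (fun e => arrivalProb (θ e) τ) f := by
  have hthinning : ∀ G : Finset α, thinning 0 G = 0 := fun G => by
    ext e
    simp [thinning]
  simp only [interpolation, hthinning, productMean_zero, Finset.empty_union, sub_zero,
    Finset.sum_const, nsmul_eq_mul]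

theorem interpolation_self_le (𝒞 : Finset (Finset α)) (θ : α → ℝ) {τ : ℝ} (hτ0 : 0 ≤ τ)
    (hτ1 : τ ≤ 1) {f : Finset α → ℝ} (hf : Monotone f) :
    interpolation 𝒞 θ τ f τ ≤ ∑ G ∈ 𝒞, f G := by
  have harrival : (fun e => arrivalProb (θ e) (τ - τ)) = 0 := by
    ext e
    simp [arrivalProb]
  refine Finset.sum_le_sum fun G _ => ?_
  simp only [harrival, productMean_zero, Finset.union_empty]
  rw [← productMean_const (thinning τ G) (f G)]
  refine Finset.sum_le_sum fun H _ => ?_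
  by_cases hH : H ⊆ G
  · exact mul_le_mul_of_nonneg_left (hf hH) (productWeight_thinning_nonneg hτ0 hτ1 G H)
  · simp [productWeight_thinning, hH]

theorem sum_productWeight_thinning_mul_nonneg {𝒞 : Finset (Finset α)} {m : ℕ}
    (hm : (𝒞 : Set (Finset α)).Sized m) {t : ℝ} (ht0 : 0 ≤ t) (ht1 : t < 1) {H : Finset α} {e : α}
    {r : ℝ} (h : (1 - t) * r * extCount 𝒞 H ≤ extCount 𝒞 (insert e H)) :
    0 ≤ ∑ G ∈ 𝒞, productWeight (thinning t G) H * ((if e ∈ G then (1 - t)⁻¹ else 0) - r) := by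
  have ht : 0 < 1 - t := sub_pos.2 ht1
  rw [sum_productWeight_thinning_mul hm]
  refine mul_nonneg (by positivity) ?_
  rw [sub_nonneg, inv_mul_eq_div, le_div_iff₀ ht]
  linarith

theorem neg_mul_sum_le_sum_productWeight_thinning_mul (𝒞 : Finset (Finset α)) {t : ℝ}
    (ht0 : 0 ≤ t) (ht1 : t ≤ 1) (H : Finset α) (e : α) (r : ℝ) :
    -(r * ∑ G ∈ 𝒞, productWeight (thinning t G) H) ≤
      ∑ G ∈ 𝒞, productWeight (thinning t G) H * ((if e ∈ G then (1 - t)⁻¹ else 0) - r) := by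
  rw [Finset.mul_sum, ← Finset.sum_neg_distrib]
  refine Finset.sum_le_sum fun G _ => ?_
  have hrate : 0 ≤ if e ∈ G then (1 - t)⁻¹ else 0 := by
    split_ifs
    exacts [inv_nonneg.2 (by linarith), le_rfl]
  linarith [mul_nonneg (productWeight_thinning_nonneg ht0 ht1 G H) hrate]

/-- On good `H` the drift is nonnegative, so only the bad ones contribute to the bound. -/
theorem neg_le_deriv_interpolation {𝒞 : Finset (Finset α)} {m : ℕ}
    (hm : (𝒞 : Set (Finset α)).Sized m) {θ : α → ℝ} (hθ : ∀ e, 0 ≤ θ e) {t τ : ℝ} (ht0 : 0 ≤ t)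
    (htτ : t ≤ τ) (ht1 : t < 1) (good : Finset α → Prop) [DecidablePred good]
    (hgood : ∀ H, good H → ∀ e, e ∉ H →
      (1 - t) * θ e * extCount 𝒞 H ≤ extCount 𝒞 (insert e H))
    {β : ℝ} (hβ : ∀ G ∈ 𝒞, ∑ H with ¬ good H, productWeight (thinning t G) H ≤ β)
    {f : Finset α → ℝ} (hf : Monotone f) (hf0 : ∀ S, 0 ≤ f S) (hf1 : ∀ S, f S ≤ 1) :
    -(𝒞.card * (β * ∑ e, θ e)) ≤ deriv (interpolation 𝒞 θ τ f) t := by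
  rw [(hasDerivAt_interpolation 𝒞 θ τ f ht1).deriv]
  have hbad : ∑ H with ¬ good H, ∑ G ∈ 𝒞, productWeight (thinning t G) H ≤ 𝒞.card * β := by
    rw [Finset.sum_comm, ← nsmul_eq_mul]
    exact Finset.sum_le_card_nsmul _ _ _ hβ
  calc -(𝒞.card * (β * ∑ e, θ e))
      ≤ ∑ H, ∑ e, if ¬ good H then -(θ e * ∑ G ∈ 𝒞, productWeight (thinning t G) H) else 0 := by
        rw [Finset.sum_comm]
        simp only [← Finset.sum_filter, Finset.sum_neg_distrib, ← Finset.mul_sum,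
          ← Finset.sum_mul]
        have hθ_sum : 0 ≤ ∑ e, θ e := Finset.sum_nonneg fun e _ => hθ e
        linarith [mul_le_mul_of_nonneg_left hbad hθ_sum]
    _ ≤ _ := Finset.sum_le_sum fun H _ => Finset.sum_le_sum fun e _ => ?_
  set D := productMean (fun e => arrivalProb (θ e) (τ - t))
    fun R => f (insert e (H ∪ R)) - f (H ∪ R) with hD
  obtain ⟨hD0, hD1⟩ : D ∈ Set.Icc 0 1 := productMean_mem_Icc
    (fun e => arrivalProb_nonneg (hθ e) (sub_nonneg.2 htτ)) (fun e => arrivalProb_le_one _ _)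
    fun R => ⟨sub_nonneg.2 (hf (Finset.subset_insert _ _)),
      by linarith [hf1 (insert e (H ∪ R)), hf0 (H ∪ R)]⟩
  split_ifs with hH
  · by_cases he : e ∈ H
    · have hDe : D = 0 := by simp [hD, he, productMean]
      rw [hDe, mul_zero]
    · exact mul_nonneg (sum_productWeight_thinning_mul_nonneg hm ht0 ht1 (hgood H hH e he)) hD0
  · have hsum : 0 ≤ ∑ G ∈ 𝒞, productWeight (thinning t G) H :=
      Finset.sum_nonneg fun G _ => productWeight_thinning_nonneg ht0 ht1.le G H
    nlinarith [mul_nonneg (hθ e) hsum,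
      neg_mul_sum_le_sum_productWeight_thinning_mul 𝒞 ht0 ht1.le H e (θ e)]

/-- If, given a good thinning `H` of a random member of `𝒞`, every `e ∉ H` is still to come with
rate at least `θ e`, then the interpolation is almost nondecreasing. -/
theorem card_mul_productMean_le {𝒞 : Finset (Finset α)} {m : ℕ}
    (hm : (𝒞 : Set (Finset α)).Sized m) {θ : α → ℝ} (hθ : ∀ e, 0 ≤ θ e) {τ : ℝ} (hτ0 : 0 ≤ τ)
    (hτ1 : τ < 1) (good : ℝ → Finset α → Prop) [∀ t, DecidablePred (good t)]
    (hgood : ∀ t, 0 ≤ t → t ≤ τ → ∀ H, good t H → ∀ e, e ∉ H →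
      (1 - t) * θ e * extCount 𝒞 H ≤ extCount 𝒞 (insert e H))
    {β : ℝ} (hβ : ∀ t, 0 ≤ t → t ≤ τ → ∀ G ∈ 𝒞,
      ∑ H with ¬ good t H, productWeight (thinning t G) H ≤ β)
    {f : Finset α → ℝ} (hf : Monotone f) (hf0 : ∀ S, 0 ≤ f S) (hf1 : ∀ S, f S ≤ 1) :
    𝒞.card * productMean (fun e => arrivalProb (θ e) τ) f ≤
      ∑ G ∈ 𝒞, f G + 𝒞.card * (τ * (β * ∑ e, θ e)) := by
  have hdiff : ∀ t ≤ τ, DifferentiableAt ℝ (interpolation 𝒞 θ τ f) t := fun t ht =>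
    (hasDerivAt_interpolation 𝒞 θ τ f (ht.trans_lt hτ1)).differentiableAt
  have hmean_value : -(𝒞.card * (β * ∑ e, θ e)) * (τ - 0) ≤
      interpolation 𝒞 θ τ f τ - interpolation 𝒞 θ τ f 0 := by
    refine (convex_Icc 0 τ).mul_sub_le_image_sub_of_le_deriv
      (fun t ht => (hdiff t ht.2).continuousAt.continuousWithinAt)
      (fun t ht => (hdiff t (interior_subset ht).2).differentiableWithinAt)
      (fun t ht => ?_) 0 ⟨le_rfl, hτ0⟩ τ ⟨hτ0, le_rfl⟩ hτ0
    obtain ⟨ht0, htτ⟩ := interior_subset ht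
    exact neg_le_deriv_interpolation hm hθ ht0 htτ (htτ.trans_lt hτ1) (good t) (hgood t ht0 htτ)
      (hβ t ht0 htτ) hf hf0 hf1
  rw [interpolation_zero] at hmean_value
  linarith [interpolation_self_le 𝒞 θ hτ0 hτ1.le hf]

end Interpolation

section Chernoff

variable {α : Type*} [DecidableEq α] [Fintype α]

theorem productMean_exp_card_inter_le {p : α → ℝ} (h0 : ∀ e, 0 ≤ p e) (h1 : ∀ e, p e ≤ 1)
    (A : Finset α) (x : ℝ) :
    (productMean p fun H => Real.exp (x * (H ∩ A).card)) ≤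
      Real.exp ((Real.exp x - 1) * ∑ e ∈ A, p e) := by
  have hprod : ∀ H : Finset α, Real.exp (x * (H ∩ A).card) =
      ∏ e ∈ H, if e ∈ A then Real.exp x else 1 := by
    intro H
    rw [Finset.prod_ite_mem, Finset.prod_const, ← Real.exp_nat_mul, mul_comm]
  simp only [hprod]
  rw [productMean_prod, Finset.mul_sum, Real.exp_sum, ← Finset.univ_inter A,
    ← Finset.prod_ite_mem]
  simp only [Finset.univ_inter]
  refine Finset.prod_le_prod (fun e _ => ?_) fun e _ => ?_
  · have hx : 0 ≤ if e ∈ A then Real.exp x else 1 := by split_ifs <;> positivity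
    linarith [mul_nonneg (h0 e) hx, h1 e]
  · split_ifs
    · linarith [Real.add_one_le_exp ((Real.exp x - 1) * p e)]
    · linarith

theorem exp_sub_one_sub_le_sq {x : ℝ} (hx : |x| ≤ 1) : Real.exp x - 1 - x ≤ x ^ 2 :=
  (le_abs_self _).trans (Real.abs_exp_sub_one_sub_id_le hx)

/-- Chernoff's bound for either tail, the upper one for `σ = 1` and the lower one for `σ = -1`. -/
theorem sum_productWeight_deviation_le {p : α → ℝ} (h0 : ∀ e, 0 ≤ p e) (h1 : ∀ e, p e ≤ 1)
    (A : Finset α) {D : ℝ} (hD : ∑ e ∈ A, p e ≤ D) {κ : ℝ} (hκ0 : 0 ≤ κ) (hκ2 : κ ≤ 2) {σ : ℝ}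
    (hσ : σ ^ 2 = 1) :
    ∑ H with κ * D < σ * ((H ∩ A).card - ∑ e ∈ A, p e), productWeight p H ≤
      Real.exp (-(κ ^ 2 / 4 * D)) := by
  set M := ∑ e ∈ A, p e
  set x : ℝ := σ * (κ / 2) with hx
  have hx_sq : x ^ 2 = κ ^ 2 / 4 := by
    rw [hx, mul_pow, hσ]
    ring
  have hx_abs : |x| ≤ 1 := by
    rw [← sq_le_one_iff_abs_le_one, hx_sq]
    nlinarith
  have hmarkov : ∀ H : Finset α, κ * D < σ * ((H ∩ A).card - M) →
      1 ≤ Real.exp (x * (H ∩ A).card) * Real.exp (-(x * M) - κ ^ 2 / 2 * D) := by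
    intro H hH
    rw [← Real.exp_add, Real.one_le_exp_iff]
    have hscaled := mul_le_mul_of_nonneg_left hH.le (by linarith : 0 ≤ κ / 2)
    have hx_dev : κ / 2 * (σ * ((H ∩ A).card - M)) = x * ((H ∩ A).card - M) := by
      rw [hx]
      ring
    linarith
  have hexponent : (Real.exp x - 1 - x) * M ≤ κ ^ 2 / 4 * D := by
    have hM : 0 ≤ M := Finset.sum_nonneg fun e _ => h0 e
    rw [← hx_sq]
    exact mul_le_mul (exp_sub_one_sub_le_sq hx_abs) hD hM (sq_nonneg x)
  calc ∑ H with κ * D < σ * ((H ∩ A).card - M), productWeight p H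
      ≤ ∑ H with κ * D < σ * ((H ∩ A).card - M), productWeight p H *
          (Real.exp (x * (H ∩ A).card) * Real.exp (-(x * M) - κ ^ 2 / 2 * D)) :=
        Finset.sum_le_sum fun H hH => le_mul_of_one_le_right (productWeight_nonneg h0 h1 H)
          (hmarkov H (Finset.mem_filter.1 hH).2)
    _ ≤ ∑ H, productWeight p H *
          (Real.exp (x * (H ∩ A).card) * Real.exp (-(x * M) - κ ^ 2 / 2 * D)) :=
        Finset.sum_le_univ_sum_of_nonneg fun H =>
          mul_nonneg (productWeight_nonneg h0 h1 H) (by positivity)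
    _ = (productMean p fun H => Real.exp (x * (H ∩ A).card)) *
          Real.exp (-(x * M) - κ ^ 2 / 2 * D) := by
        simp only [productMean, Finset.sum_mul, mul_assoc]
    _ ≤ Real.exp ((Real.exp x - 1) * M) * Real.exp (-(x * M) - κ ^ 2 / 2 * D) :=
        mul_le_mul_of_nonneg_right (productMean_exp_card_inter_le h0 h1 A x) (Real.exp_pos _).le
    _ ≤ Real.exp (-(κ ^ 2 / 4 * D)) := by
        rw [← Real.exp_add, Real.exp_le_exp]
        linarith

end Chernoff

section EdgeDegree

variable {V : Type*} [DecidableEq V]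

/-- The number of edges of `E` at `v`; a loop counts once. -/
def edgeDeg (E : Finset (Sym2 V)) (v : V) : ℕ := {e ∈ E | v ∈ e}.card

theorem edgeDeg_mono {E F : Finset (Sym2 V)} (h : E ⊆ F) (v : V) : edgeDeg E v ≤ edgeDeg F v :=
  Finset.card_le_card (Finset.filter_subset_filter _ h)

theorem edgeDeg_sdiff {G H : Finset (Sym2 V)} (h : H ⊆ G) (v : V) :
    edgeDeg (G \ H) v = edgeDeg G v - edgeDeg H v := by
  have hfilter : {e ∈ G \ H | v ∈ e} = {e ∈ G | v ∈ e} \ {e ∈ H | v ∈ e} := by grind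
  rw [edgeDeg, hfilter, Finset.card_sdiff_of_subset (Finset.filter_subset_filter _ h), edgeDeg,
    edgeDeg]

theorem edgeDeg_insert {E : Finset (Sym2 V)} {e : Sym2 V} (he : e ∉ E) (v : V) :
    edgeDeg (insert e E) v = edgeDeg E v + if v ∈ e then 1 else 0 := by
  simp only [edgeDeg, Finset.card_filter]
  rw [Finset.sum_insert he, add_comm]

theorem edgeDeg_erase {E : Finset (Sym2 V)} {e : Sym2 V} (he : e ∈ E) (v : V) :
    edgeDeg (E.erase e) v + (if v ∈ e then 1 else 0) = edgeDeg E v := by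
  rw [← edgeDeg_insert (Finset.notMem_erase e E), Finset.insert_erase he]

theorem indicator_mem_mk {x y : V} (h : x ≠ y) (v : V) :
    (if v ∈ s(x, y) then 1 else 0) = (if v = x then 1 else 0) + if v = y then 1 else 0 := by
  by_cases hv : v = x
  · subst hv
    simp [h]
  · simp [hv]

variable [Fintype V]

theorem sum_indicator_mem (e : Sym2 V) :
    (∑ v, if v ∈ e then 1 else 0) = if e.IsDiag then 1 else 2 := by
  rw [← Sym2.card_toFinset, ← Finset.card_filter]
  congr 1
  ext v
  simp

theorem sum_edgeDeg_eq_two_mul_card {E : Finset (Sym2 V)} (hE : ∀ e ∈ E, ¬ e.IsDiag) :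
    ∑ v, edgeDeg E v = 2 * E.card := by
  simp only [edgeDeg, Finset.card_filter]
  rw [Finset.sum_comm, Finset.sum_congr rfl fun e he => (sum_indicator_mem e).trans
    (if_neg (hE e he)), Finset.sum_const, smul_eq_mul, mul_comm]

theorem card_filter_mk_mem (E : Finset (Sym2 V)) (v : V) :
    Finset.card {a | s(v, a) ∈ E} = edgeDeg E v := by
  refine Finset.card_bij (fun a _ => s(v, a)) (fun a ha => by simpa using ha)
    (fun a _ b _ hab => Sym2.congr_right.1 hab) fun e he => ?_
  obtain ⟨he_mem, a, rfl⟩ := Finset.mem_filter.1 he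
  exact ⟨a, by simpa using he_mem, rfl⟩

theorem card_filter_mk_mem_fst (E : Finset (Sym2 V)) (S : Finset V) :
    Finset.card {p : V × V | s(p.1, p.2) ∈ E ∧ p.1 ∈ S} = ∑ a ∈ S, edgeDeg E a := by
  rw [Finset.card_filter, Fintype.sum_prod_type, ← Finset.sum_subset (Finset.subset_univ S)]
  · refine Finset.sum_congr rfl fun a ha => ?_
    rw [← card_filter_mk_mem, Finset.card_filter]
    simp only [ha, and_true]
  · intro a _ ha
    simp only [ha, and_false, if_false, Finset.sum_const_zero]

theorem card_filter_mk_mem_snd (E : Finset (Sym2 V)) (S : Finset V) :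
    Finset.card {p : V × V | s(p.1, p.2) ∈ E ∧ p.2 ∈ S} = ∑ a ∈ S, edgeDeg E a := by
  rw [← card_filter_mk_mem_fst, Finset.card_filter, Finset.card_filter,
    ← Equiv.sum_comp (Equiv.prodComm V V)]
  simp only [Equiv.prodComm_apply, Prod.fst_swap, Prod.snd_swap, Sym2.eq_swap]

theorem card_filter_mk_mem_prod (E : Finset (Sym2 V)) :
    Finset.card {p : V × V | s(p.1, p.2) ∈ E} = ∑ a, edgeDeg E a := by
  simpa using card_filter_mk_mem_fst E Finset.univ

theorem card_insert_filter_mk_mem_le {E : Finset (Sym2 V)} {Δ : ℕ} {v : V}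
    (hΔ : edgeDeg E v ≤ Δ) : (insert v ({a | s(v, a) ∈ E} : Finset V)).card ≤ Δ + 1 := by
  rw [← card_filter_mk_mem] at hΔ
  exact (Finset.card_insert_le _ _).trans (Nat.succ_le_succ hΔ)

end EdgeDegree

section Reroute

variable {V : Type*} [DecidableEq V]

/-- The edge `ab` of `G` can be cut and its ends `a` and `b` attached to `u` and `v` without
creating a loop or a multiple edge. -/
structure CanReroute (G : Finset (Sym2 V)) (u v a b : V) : Prop where
  mem : s(a, b) ∈ G
  ne_left : u ≠ a
  ne_right : v ≠ b
  notMem_left : s(u, a) ∉ G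
  notMem_right : s(v, b) ∉ G

instance (G : Finset (Sym2 V)) (u v a b : V) : Decidable (CanReroute G u v a b) :=
  decidable_of_iff (s(a, b) ∈ G ∧ u ≠ a ∧ v ≠ b ∧ s(u, a) ∉ G ∧ s(v, b) ∉ G)
    ⟨fun ⟨h₁, h₂, h₃, h₄, h₅⟩ => ⟨h₁, h₂, h₃, h₄, h₅⟩,
      fun ⟨h₁, h₂, h₃, h₄, h₅⟩ => ⟨h₁, h₂, h₃, h₄, h₅⟩⟩

/-- The graph `G` with the edge `ab` replaced by the edges `ua` and `vb`. -/
def reroute (G : Finset (Sym2 V)) (u v a b : V) : Finset (Sym2 V) :=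
  insert s(u, a) (insert s(v, b) (G.erase s(a, b)))

/-- The switching of the edges `jk` and `ab` of `G` into the edges `ja` and `kb`. -/
def switch (G : Finset (Sym2 V)) (j k a b : V) : Finset (Sym2 V) :=
  (reroute G j k a b).erase s(j, k)

theorem subset_switch {G H : Finset (Sym2 V)} {j k a b : V} (hHG : H ⊆ G)
    (hjk : s(j, k) ∉ H) (hab : s(a, b) ∉ H) : H ⊆ switch G j k a b := by
  intro e he
  have hne_jk : e ≠ s(j, k) := fun h_eq => hjk (h_eq ▸ he)
  have hne_ab : e ≠ s(a, b) := fun h_eq => hab (h_eq ▸ he)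
  simp [switch, reroute, hne_jk, hne_ab, hHG he]

namespace CanReroute

variable {G : Finset (Sym2 V)} {u v a b j k : V}

theorem notMem_insert (h : CanReroute G u v a b) (hG : ∀ e ∈ G, ¬ e.IsDiag) :
    s(u, a) ∉ insert s(v, b) (G.erase s(a, b)) := by
  have hab : a ≠ b := fun hab => hG _ h.mem hab
  have hba : s(b, a) ∈ G := Sym2.eq_swap ▸ h.mem
  have hua := h.notMem_left
  simp only [Finset.mem_insert, Finset.mem_erase, Sym2.eq_iff]
  rintro ((⟨-, h_eq⟩ | ⟨rfl, -⟩) | ⟨-, hmem⟩)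
  exacts [hab h_eq, hua hba, hua hmem]

theorem card_reroute (h : CanReroute G u v a b) (hG : ∀ e ∈ G, ¬ e.IsDiag) :
    (reroute G u v a b).card = G.card + 1 := by
  rw [reroute, Finset.card_insert_of_notMem (h.notMem_insert hG), Finset.card_insert_of_notMem
    fun hmem => h.notMem_right (Finset.mem_of_mem_erase hmem), Finset.card_erase_add_one h.mem]

theorem edgeDeg_reroute (h : CanReroute G u v a b) (hG : ∀ e ∈ G, ¬ e.IsDiag) (w : V) :
    edgeDeg (reroute G u v a b) w =
      edgeDeg G w + ((if w = u then 1 else 0) + if w = v then 1 else 0) := by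
  have hab : a ≠ b := fun hab => hG _ h.mem hab
  have herase := edgeDeg_erase h.mem w
  rw [indicator_mem_mk hab] at herase
  rw [reroute, edgeDeg_insert (h.notMem_insert hG), edgeDeg_insert
    fun hmem => h.notMem_right (Finset.mem_of_mem_erase hmem), indicator_mem_mk h.ne_left,
    indicator_mem_mk h.ne_right]
  omega

theorem not_isDiag_of_mem_reroute (h : CanReroute G u v a b) (hG : ∀ e ∈ G, ¬ e.IsDiag) :
    ∀ e ∈ reroute G u v a b, ¬ e.IsDiag := by
  simp only [reroute, Finset.mem_insert, Finset.mem_erase]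
  rintro e (rfl | rfl | ⟨-, he⟩)
  exacts [h.ne_left, h.ne_right, hG e he]

theorem canReroute_switch (h : CanReroute G j k a b) (hjk : s(j, k) ∈ G)
    (hG : ∀ e ∈ G, ¬ e.IsDiag) :
    CanReroute (switch G j k a b) j a k b := by
  have hne : s(k, b) ≠ s(j, k) := fun h_eq => h.notMem_right (h_eq ▸ hjk)
  have hab_ne : s(a, b) ≠ s(j, a) := fun h_eq => h.notMem_left (h_eq ▸ h.mem)
  have hab_ne' : s(a, b) ≠ s(k, b) := fun h_eq => h.notMem_right (h_eq ▸ h.mem)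
  exact ⟨by simp [switch, reroute, hne], hG _ hjk, hG _ h.mem,
    Finset.notMem_erase _ _, by simp [switch, reroute, hab_ne, hab_ne']⟩

theorem mk_mem_switch (h : CanReroute G j k a b) (hjk : s(j, k) ∈ G) :
    s(j, a) ∈ switch G j k a b := by
  have hne : s(j, a) ≠ s(j, k) := fun h_eq => h.notMem_left (h_eq ▸ hjk)
  simp [switch, reroute, hne]

theorem switch_switch (h : CanReroute G j k a b) (hjk : s(j, k) ∈ G) :
    switch (switch G j k a b) j a k b = G := by
  ext e
  simp only [switch, reroute, Finset.mem_insert, Finset.mem_erase]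
  have := h.mem
  have := h.notMem_left
  have := h.notMem_right
  grind

end CanReroute

end Reroute

section Switching

variable {V : Type*} [Fintype V] [DecidableEq V]

/-- The ordered pairs `ab` of adjacent vertices with `ab ∈ E` that can be rerouted to `u` and `v`
in `G`. -/
def reroutable (G E : Finset (Sym2 V)) (u v : V) : Finset (V × V) :=
  {p | s(p.1, p.2) ∈ E ∧ CanReroute G u v p.1 p.2}

theorem sum_edgeDeg_le_card_reroutable {G E : Finset (Sym2 V)} (hE : E ⊆ G) {Δ : ℕ}
    (hΔ : ∀ v, edgeDeg G v ≤ Δ) (u v : V) :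
    ∑ a, edgeDeg E a ≤ (reroutable G E u v).card + 2 * (Δ * (Δ + 1)) := by
  let closedNbhd (w : V) : Finset V := insert w ({a | s(w, a) ∈ G} : Finset V)
  have hnbhd : ∀ w, ∑ a ∈ closedNbhd w, edgeDeg E a ≤ Δ * (Δ + 1) := by
    intro w
    refine (Finset.sum_le_card_nsmul _ _ Δ fun a _ => (edgeDeg_mono hE a).trans (hΔ a)).trans ?_
    rw [smul_eq_mul, mul_comm]
    exact Nat.mul_le_mul_left _ (card_insert_filter_mk_mem_le (hΔ w))
  have hcover : ({p : V × V | s(p.1, p.2) ∈ E} : Finset (V × V)) ⊆ reroutable G E u v ∪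
      (({p : V × V | s(p.1, p.2) ∈ E ∧ p.1 ∈ closedNbhd u} : Finset (V × V)) ∪
        ({p : V × V | s(p.1, p.2) ∈ E ∧ p.2 ∈ closedNbhd v} : Finset (V × V))) := by
    intro p hp
    simp only [reroutable, closedNbhd, Finset.mem_union, Finset.mem_filter, Finset.mem_univ,
      true_and, Finset.mem_insert] at hp ⊢
    by_contra! h
    exact h.1 hp ⟨hE hp, Ne.symm (h.2.1 hp).1, Ne.symm (h.2.2 hp).1, (h.2.1 hp).2, (h.2.2 hp).2⟩
  calc ∑ a, edgeDeg E a = Finset.card {p : V × V | s(p.1, p.2) ∈ E} :=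
        (card_filter_mk_mem_prod E).symm
    _ ≤ (reroutable G E u v).card +
        (∑ a ∈ closedNbhd u, edgeDeg E a + ∑ a ∈ closedNbhd v, edgeDeg E a) := by
        rw [← card_filter_mk_mem_fst, ← card_filter_mk_mem_snd]
        exact (Finset.card_le_card hcover).trans ((Finset.card_union_le _ _).trans
          (Nat.add_le_add_left (Finset.card_union_le _ _) _))
    _ ≤ (reroutable G E u v).card + 2 * (Δ * (Δ + 1)) := by
        linarith [hnbhd u, hnbhd v]

/-- The edge sets of the simple graphs with degree sequence `d`. -/
def degreeFamily (d : V → ℕ) : Finset (Finset (Sym2 V)) :=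
  {G | (∀ e ∈ G, ¬ e.IsDiag) ∧ ∀ v, edgeDeg G v = d v}

theorem mem_degreeFamily {d : V → ℕ} {G : Finset (Sym2 V)} :
    G ∈ degreeFamily d ↔ (∀ e ∈ G, ¬ e.IsDiag) ∧ ∀ v, edgeDeg G v = d v := by
  simp [degreeFamily]

theorem switch_mem_degreeFamily {d : V → ℕ} {G : Finset (Sym2 V)} (hG : G ∈ degreeFamily d)
    {j k a b : V} (hjk : s(j, k) ∈ G) (h : CanReroute G j k a b) :
    switch G j k a b ∈ degreeFamily d := by
  rw [mem_degreeFamily] at hG ⊢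
  obtain ⟨hloop, hdeg⟩ := hG
  have hjk_mem : s(j, k) ∈ reroute G j k a b := by
    have := h.ne_left
    have := h.notMem_left
    simp only [reroute, Finset.mem_insert, Finset.mem_erase]
    grind
  refine ⟨fun e he => h.not_isDiag_of_mem_reroute hloop e (Finset.mem_of_mem_erase he),
    fun w => ?_⟩
  have herase := edgeDeg_erase hjk_mem w
  rw [indicator_mem_mk (hloop _ hjk), h.edgeDeg_reroute hloop, hdeg] at herase
  exact Nat.add_right_cancel herase

/-- The number of edges still missing at `v` when the edges of `H` are present. -/
def residualDeg (d : V → ℕ) (H : Finset (Sym2 V)) (v : V) : ℕ := d v - edgeDeg H v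

theorem residualDeg_eq_edgeDeg {d : V → ℕ} {G H : Finset (Sym2 V)} (hG : G ∈ degreeFamily d)
    (h : H ⊆ G) (v : V) : residualDeg d H v = edgeDeg (G \ H) v := by
  rw [edgeDeg_sdiff h, residualDeg, (mem_degreeFamily.1 hG).2]

omit [Fintype V] in
theorem residualDeg_anti (d : V → ℕ) {H K : Finset (Sym2 V)} (h : H ⊆ K) (v : V) :
    residualDeg d K v ≤ residualDeg d H v :=
  Nat.sub_le_sub_left (edgeDeg_mono h v) _

theorem sum_residualDeg_le_insert (d : V → ℕ) (H : Finset (Sym2 V)) (e : Sym2 V) :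
    ∑ v, residualDeg d H v ≤ ∑ v, residualDeg d (insert e H) v + 2 := by
  have hstep : ∀ v, residualDeg d H v ≤
      residualDeg d (insert e H) v + if v ∈ e then 1 else 0 := by
    intro v
    by_cases he : e ∈ H
    · rw [Finset.insert_eq_of_mem he]
      exact Nat.le_add_right _ _
    · rw [residualDeg, residualDeg, edgeDeg_insert he]
      omega
  have hsum := Finset.sum_le_sum fun v (_ : v ∈ Finset.univ) => hstep v
  rw [Finset.sum_add_distrib, sum_indicator_mem] at hsum
  split_ifs at hsum <;> omega

theorem card_filter_mk_mem_mk_mem {d : V → ℕ} {G H : Finset (Sym2 V)} (hG : G ∈ degreeFamily d)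
    (h : H ⊆ G) (j k : V) :
    Finset.card {p : V × V | s(j, p.1) ∈ G \ H ∧ s(k, p.2) ∈ G \ H} =
      residualDeg d H j * residualDeg d H k := by
  rw [residualDeg_eq_edgeDeg hG h, residualDeg_eq_edgeDeg hG h, ← card_filter_mk_mem,
    ← card_filter_mk_mem, ← Finset.card_product, ← Finset.filter_product, Finset.univ_product_univ]

/-- The pairs `(a, b)` for which the edges `ja` and `kb` of `G \ H` can be switched into `jk` and
`ab`. -/
def switchablePairs (G H : Finset (Sym2 V)) (j k : V) : Finset (V × V) :=
  {p | s(j, p.1) ∈ G \ H ∧ s(k, p.2) ∈ G \ H ∧ CanReroute G j p.1 k p.2}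

/-- The pairs `(a, b)` for which `ja` and `kb` are edges of `G \ H` and `jk` is missing, but the
edges cannot be switched since `ab` is already present. -/
def blockedPairs (G H : Finset (Sym2 V)) (j k : V) : Finset (V × V) :=
  {p | s(j, k) ∉ G ∧ s(j, p.1) ∈ G \ H ∧ s(k, p.2) ∈ G \ H ∧ s(p.1, p.2) ∈ G}

theorem card_switchablePairs_le {d : V → ℕ} {G H : Finset (Sym2 V)} (hG : G ∈ degreeFamily d)
    (h : H ⊆ G) (j k : V) :
    (switchablePairs G H j k).card ≤ residualDeg d H j * residualDeg d H k := by
  rw [← card_filter_mk_mem_mk_mem hG h]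
  exact Finset.card_le_card
    (Finset.monotone_filter_right _ fun _ _ hp => ⟨hp.1, hp.2.1⟩)

theorem residualDeg_mul_le_card_switchablePairs {d : V → ℕ} {G H : Finset (Sym2 V)}
    (hG : G ∈ degreeFamily d) (h : H ⊆ G) {j k : V} (hjk : j ≠ k) (hjkG : s(j, k) ∉ G) :
    residualDeg d H j * residualDeg d H k ≤
      (switchablePairs G H j k).card + (blockedPairs G H j k).card + residualDeg d H j := by
  have hdiag : residualDeg d H j =
      (Finset.image (fun a => (a, a)) ({a | s(j, a) ∈ G \ H} : Finset V)).card := by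
    rw [residualDeg_eq_edgeDeg hG h, ← card_filter_mk_mem, Finset.card_image_of_injective]
    exact fun a b hab => (Prod.mk.inj hab).1
  rw [← card_filter_mk_mem_mk_mem hG h]
  rw [hdiag]
  refine (Finset.card_le_card fun p hp => ?_).trans ((Finset.card_union_le _ _).trans
    (Nat.add_le_add_right (Finset.card_union_le _ _) _))
  obtain ⟨a, b⟩ := p
  simp only [Finset.mem_filter, Finset.mem_univ, true_and] at hp
  obtain ⟨hja, hkb⟩ := hp
  simp only [Finset.mem_union, switchablePairs, blockedPairs, Finset.mem_filter, Finset.mem_univ,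
    true_and, Finset.mem_image, Prod.mk.injEq]
  by_cases hab : a = b
  · exact Or.inr ⟨a, hja, rfl, hab⟩
  by_cases habG : s(a, b) ∈ G
  · exact Or.inl (Or.inr ⟨hjkG, hja, hkb, habG⟩)
  · exact Or.inl (Or.inl ⟨hja, hkb, (Finset.mem_sdiff.1 hkb).1, hjk, hab, hjkG, habG⟩)

theorem sum_card_reroutable_eq (d : V → ℕ) {H : Finset (Sym2 V)} {j k : V} (hH : s(j, k) ∉ H) :
    ∑ G ∈ degreeFamily d with insert s(j, k) H ⊆ G, (reroutable G (G \ H) j k).card =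
      ∑ G ∈ degreeFamily d with H ⊆ G, (switchablePairs G H j k).card := by
  rw [← Finset.card_sigma, ← Finset.card_sigma]
  refine Finset.card_nbij' (fun x => ⟨switch x.1 j k x.2.1 x.2.2, x.2⟩)
    (fun x => ⟨switch x.1 j x.2.1 k x.2.2, x.2⟩) ?_ ?_ ?_ ?_
  all_goals
    rintro ⟨G, a, b⟩ hx
    simp only [Finset.coe_sigma, Set.mem_sigma_iff, Finset.mem_coe, Finset.mem_filter, reroutable,
      switchablePairs, Finset.mem_univ, true_and, Finset.mem_sdiff,
      Finset.insert_subset_iff] at hx ⊢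
  · obtain ⟨⟨hG, hjk, hHG⟩, ⟨-, habH⟩, h⟩ := hx
    have hloop := (mem_degreeFamily.1 hG).1
    have hswitch := h.canReroute_switch hjk hloop
    exact ⟨⟨switch_mem_degreeFamily hG hjk h, subset_switch hHG hH habH⟩,
      ⟨h.mk_mem_switch hjk, fun hja => h.notMem_left (hHG hja)⟩,
      ⟨hswitch.mem, fun hkb => h.notMem_right (hHG hkb)⟩, hswitch⟩
  · obtain ⟨⟨hG, hHG⟩, ⟨hja, hjaH⟩, ⟨-, hkbH⟩, h⟩ := hx
    have hloop := (mem_degreeFamily.1 hG).1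
    have hswitch := h.canReroute_switch hja hloop
    exact ⟨⟨switch_mem_degreeFamily hG hja h, h.mk_mem_switch hja, subset_switch hHG hjaH hkbH⟩,
      ⟨hswitch.mem, fun hab => h.notMem_right (hHG hab)⟩, hswitch⟩
  · obtain ⟨⟨-, hjk, -⟩, -, h⟩ := hx
    rw [h.switch_switch hjk]
  · obtain ⟨-, ⟨hja, -⟩, -, h⟩ := hx
    rw [h.switch_switch hja]

end Switching

section ConditionalEdgeProbability

theorem extCount_insert {α : Type*} [DecidableEq α] (𝒞 : Finset (Finset α)) (e : α)
    (H : Finset α) :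
    extCount 𝒞 (insert e H) = {G ∈ {G ∈ 𝒞 | H ⊆ G} | e ∈ G}.card := by
  simp only [extCount, Finset.filter_filter, Finset.insert_subset_iff, and_comm]

variable {V : Type*} [Fintype V] [DecidableEq V] {d : V → ℕ} {Δ : ℕ} {H : Finset (Sym2 V)}

theorem sum_extCount_insert (d : V → ℕ) (H : Finset (Sym2 V)) :
    ∑ p : V × V, extCount (degreeFamily d) (insert s(p.1, p.2) H) =
      (∑ v, d v) * extCount (degreeFamily d) H := by
  simp only [extCount_insert, Finset.card_filter]
  rw [Finset.sum_comm]
  simp only [← Finset.card_filter, card_filter_mk_mem_prod]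
  rw [mul_comm, extCount, ← smul_eq_mul, ← Finset.sum_const]
  refine Finset.sum_congr rfl fun G hG => ?_
  simp only [(mem_degreeFamily.1 (Finset.mem_filter.1 hG).1).2]

theorem extCount_insert_mul_sum_residualDeg_le (hΔ : ∀ v, d v ≤ Δ) {j k : V}
    (hH : s(j, k) ∉ H) :
    extCount (degreeFamily d) (insert s(j, k) H) * ∑ v, residualDeg d H v ≤
      residualDeg d H j * residualDeg d H k * extCount (degreeFamily d) H +
        extCount (degreeFamily d) (insert s(j, k) H) * (2 * (Δ * (Δ + 1))) := by
  have hreroutable : ∀ G ∈ {G ∈ degreeFamily d | insert s(j, k) H ⊆ G},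
      ∑ v, residualDeg d H v ≤ (reroutable G (G \ H) j k).card + 2 * (Δ * (Δ + 1)) := by
    intro G hG
    obtain ⟨hGd, hsub⟩ := Finset.mem_filter.1 hG
    have hHG := (Finset.insert_subset_iff.1 hsub).2
    rw [Finset.sum_congr rfl fun v _ => residualDeg_eq_edgeDeg hGd hHG v]
    exact sum_edgeDeg_le_card_reroutable Finset.sdiff_subset
      (fun v => by rw [(mem_degreeFamily.1 hGd).2]; exact hΔ v) j k
  have hswitchable : ∀ G ∈ {G ∈ degreeFamily d | H ⊆ G},
      (switchablePairs G H j k).card ≤ residualDeg d H j * residualDeg d H k := by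
    intro G hG
    obtain ⟨hGd, hHG⟩ := Finset.mem_filter.1 hG
    exact card_switchablePairs_le hGd hHG j k
  have hlower := Finset.sum_le_sum hreroutable
  have hupper := Finset.sum_le_sum hswitchable
  rw [Finset.sum_add_distrib, sum_card_reroutable_eq d hH, Finset.sum_const, Finset.sum_const,
    smul_eq_mul, smul_eq_mul] at hlower
  rw [Finset.sum_const, smul_eq_mul] at hupper
  simp only [extCount]
  linarith

theorem residualDeg_mul_extCount_le {j k : V} (hjk : j ≠ k) (hH : s(j, k) ∉ H) :
    residualDeg d H j * residualDeg d H k * extCount (degreeFamily d) H ≤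
      (∑ v, residualDeg d H v + residualDeg d H j * residualDeg d H k) *
        extCount (degreeFamily d) (insert s(j, k) H) +
      residualDeg d H j * extCount (degreeFamily d) H +
      ∑ G ∈ degreeFamily d with H ⊆ G, (blockedPairs G H j k).card := by
  have hswitchable : ∀ G ∈ {G ∈ degreeFamily d | H ⊆ G}, residualDeg d H j * residualDeg d H k ≤
      (switchablePairs G H j k).card + (blockedPairs G H j k).card + residualDeg d H j +
        if s(j, k) ∈ G then residualDeg d H j * residualDeg d H k else 0 := by
    intro G hG
    obtain ⟨hGd, hHG⟩ := Finset.mem_filter.1 hG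
    split_ifs with hjkG
    · exact Nat.le_add_left _ _
    · exact residualDeg_mul_le_card_switchablePairs hGd hHG hjk hjkG
  have hreroutable : ∀ G ∈ {G ∈ degreeFamily d | insert s(j, k) H ⊆ G},
      (reroutable G (G \ H) j k).card ≤ ∑ v, residualDeg d H v := by
    intro G hG
    obtain ⟨hGd, hsub⟩ := Finset.mem_filter.1 hG
    have hHG := (Finset.insert_subset_iff.1 hsub).2
    rw [Finset.sum_congr rfl fun v _ => residualDeg_eq_edgeDeg hGd hHG v,
      ← card_filter_mk_mem_prod]
    exact Finset.card_le_card (Finset.monotone_filter_right _ fun _ _ hp => hp.1)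
  have hlower := Finset.sum_le_sum hswitchable
  have hupper := Finset.sum_le_sum hreroutable
  rw [Finset.sum_const, Finset.sum_add_distrib, Finset.sum_add_distrib, Finset.sum_add_distrib,
    Finset.sum_const, ← Finset.sum_filter, Finset.sum_const, ← extCount_insert,
    ← sum_card_reroutable_eq d hH] at hlower
  rw [Finset.sum_const] at hupper
  simp only [smul_eq_mul] at hlower hupper
  simp only [extCount] at hlower ⊢
  linarith

theorem extCount_insert_mul_le (hΔ : ∀ v, d v ≤ Δ) {j k : V} (hH : s(j, k) ∉ H) {X : ℝ}
    (hX : X + 2 * (Δ * (Δ + 1)) ≤ (∑ v, residualDeg d H v : ℕ)) :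
    extCount (degreeFamily d) (insert s(j, k) H) * X ≤
      residualDeg d H j * residualDeg d H k * (extCount (degreeFamily d) H : ℝ) := by
  have hcount : ((extCount (degreeFamily d) (insert s(j, k) H) * ∑ v, residualDeg d H v : ℕ) : ℝ) ≤
    _ := Nat.cast_le.2 (extCount_insert_mul_sum_residualDeg_le hΔ hH)
  have hscaled := mul_le_mul_of_nonneg_left hX
    (Nat.cast_nonneg (α := ℝ) (extCount (degreeFamily d) (insert s(j, k) H)))
  push_cast at hcount hscaled
  linarith

theorem extCount_insert_insert_mul_sq_le (hΔ : ∀ v, d v ≤ Δ) {j k a b : V} (hja : s(j, a) ∉ H)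
    (hkb : s(k, b) ∉ insert s(j, a) H) {X : ℝ} (hX0 : 0 ≤ X)
    (hX : X + 2 * (Δ * (Δ + 1)) + 2 ≤ (∑ v, residualDeg d H v : ℕ)) :
    extCount (degreeFamily d) (insert s(k, b) (insert s(j, a) H)) * X ^ 2 ≤
      residualDeg d H j * residualDeg d H k * (Δ : ℝ) ^ 2 * extCount (degreeFamily d) H := by
  have hsum : ((∑ v, residualDeg d H v : ℕ) : ℝ) ≤
      (∑ v, residualDeg d (insert s(j, a) H) v : ℕ) + 2 := by
    exact_mod_cast sum_residualDeg_le_insert d H s(j, a)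
  have hresidual : ∀ (K : Finset (Sym2 V)) (x y : V), H ⊆ K →
      (residualDeg d K x * residualDeg d K y : ℝ) ≤ residualDeg d H x * Δ := by
    intro K x y hK
    exact_mod_cast Nat.mul_le_mul (residualDeg_anti d hK x) ((Nat.sub_le _ _).trans (hΔ y))
  have hfirst := (extCount_insert_mul_le hΔ hja (X := X) (by linarith)).trans
    (mul_le_mul_of_nonneg_right (hresidual H j a subset_rfl) (Nat.cast_nonneg _))
  have hsecond := (extCount_insert_mul_le hΔ hkb (X := X) (by linarith)).trans
    (mul_le_mul_of_nonneg_right (hresidual _ k b (Finset.subset_insert _ _)) (Nat.cast_nonneg _))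
  calc (extCount (degreeFamily d) (insert s(k, b) (insert s(j, a) H)) : ℝ) * X ^ 2
      = extCount (degreeFamily d) (insert s(k, b) (insert s(j, a) H)) * X * X := by ring
    _ ≤ residualDeg d H k * Δ * extCount (degreeFamily d) (insert s(j, a) H) * X :=
        mul_le_mul_of_nonneg_right hsecond hX0
    _ = residualDeg d H k * Δ * (extCount (degreeFamily d) (insert s(j, a) H) * X) := by ring
    _ ≤ residualDeg d H k * Δ * (residualDeg d H j * Δ * extCount (degreeFamily d) H) :=
        mul_le_mul_of_nonneg_left hfirst (by positivity)
    _ = residualDeg d H j * residualDeg d H k * (Δ : ℝ) ^ 2 * extCount (degreeFamily d) H := by ring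

theorem card_mem_blockedPairs_mul_sq_le (hΔ : ∀ v, d v ≤ Δ) {j k : V} (hjk : j ≠ k) {X : ℝ}
    (hX0 : 0 ≤ X) (hX : X + 2 * (Δ * (Δ + 1)) + 4 ≤ (∑ v, residualDeg d H v : ℕ)) (p : V × V) :
    ({G ∈ {G ∈ degreeFamily d | H ⊆ G} | p ∈ blockedPairs G H j k}.card : ℝ) * X ^ 2 ≤
      residualDeg d H j * residualDeg d H k * (Δ : ℝ) ^ 2 *
        extCount (degreeFamily d) (insert s(p.1, p.2) H) := by
  obtain ⟨a, b⟩ := p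
  rcases Finset.eq_empty_or_nonempty
    {G ∈ {G ∈ degreeFamily d | H ⊆ G} | (a, b) ∈ blockedPairs G H j k} with hempty | ⟨G, hG⟩
  · rw [hempty, Finset.card_empty, Nat.cast_zero, zero_mul]
    positivity
  simp only [blockedPairs, Finset.mem_filter, Finset.mem_univ, true_and, Finset.mem_sdiff] at hG
  obtain ⟨⟨hGd, -⟩, hjkG, ⟨hjaG, hjaH⟩, ⟨hkbG, hkbH⟩, -⟩ := hG
  have hloop := (mem_degreeFamily.1 hGd).1
  have hja : s(j, a) ∉ insert s(a, b) H := by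
    have := hloop _ hjaG
    grind
  have hkb : s(k, b) ∉ insert s(j, a) (insert s(a, b) H) := by
    have := hloop _ hkbG
    grind
  have hsub : {G ∈ {G ∈ degreeFamily d | H ⊆ G} | (a, b) ∈ blockedPairs G H j k} ⊆
      {G ∈ degreeFamily d | insert s(k, b) (insert s(j, a) (insert s(a, b) H)) ⊆ G} := by
    intro G hG
    simp only [blockedPairs, Finset.mem_filter, Finset.mem_univ, true_and, Finset.mem_sdiff,
      Finset.insert_subset_iff] at hG ⊢
    tauto
  have hsum : ((∑ v, residualDeg d H v : ℕ) : ℝ) ≤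
      (∑ v, residualDeg d (insert s(a, b) H) v : ℕ) + 2 := by
    exact_mod_cast sum_residualDeg_le_insert d H s(a, b)
  have hpath := extCount_insert_insert_mul_sq_le hΔ hja hkb hX0 (by linarith)
  refine (mul_le_mul_of_nonneg_right (Nat.cast_le.2 (Finset.card_le_card hsub))
    (sq_nonneg X)).trans (hpath.trans ?_)
  gcongr <;> exact residualDeg_anti d (Finset.subset_insert _ _) _

theorem sum_card_blockedPairs_mul_sq_le (hΔ : ∀ v, d v ≤ Δ) {j k : V} (hjk : j ≠ k) {X : ℝ}
    (hX0 : 0 ≤ X) (hX : X + 2 * (Δ * (Δ + 1)) + 4 ≤ (∑ v, residualDeg d H v : ℕ)) :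
    (∑ G ∈ degreeFamily d with H ⊆ G, (blockedPairs G H j k).card : ℕ) * X ^ 2 ≤
      residualDeg d H j * residualDeg d H k * ((Δ : ℝ) ^ 2 * (∑ v, d v : ℕ)) *
        extCount (degreeFamily d) H := by
  have hswap : ∑ G ∈ degreeFamily d with H ⊆ G, (blockedPairs G H j k).card =
      ∑ p : V × V, {G ∈ {G ∈ degreeFamily d | H ⊆ G} | p ∈ blockedPairs G H j k}.card := by
    simpa only [Finset.bipartiteAbove, Finset.bipartiteBelow, Finset.filter_univ_mem] using
      Finset.sum_card_bipartiteAbove_eq_sum_card_bipartiteBelow (s := {G ∈ degreeFamily d | H ⊆ G})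
        (t := Finset.univ) fun G p => p ∈ blockedPairs G H j k
  rw [hswap, Nat.cast_sum, Finset.sum_mul]
  refine (Finset.sum_le_sum fun p _ => card_mem_blockedPairs_mul_sq_le hΔ hjk hX0 hX p).trans ?_
  rw [← Finset.mul_sum, ← Nat.cast_sum, sum_extCount_insert, Nat.cast_mul]
  exact le_of_eq (by ring)

theorem residualDeg_mul_le_extCount_insert (hΔ : ∀ v, d v ≤ Δ) {j k : V} (hjk : j ≠ k)
    (hH : s(j, k) ∉ H) {X : ℝ} (hX0 : 0 < X)
    (hX : X + 2 * (Δ * (Δ + 1)) + 4 ≤ (∑ v, residualDeg d H v : ℕ)) :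
    residualDeg d H j * residualDeg d H k * (extCount (degreeFamily d) H : ℝ) ≤
      ((∑ v, residualDeg d H v : ℕ) + residualDeg d H j * residualDeg d H k) *
        extCount (degreeFamily d) (insert s(j, k) H) +
      residualDeg d H j * extCount (degreeFamily d) H +
      residualDeg d H j * residualDeg d H k * ((Δ : ℝ) ^ 2 * (∑ v, d v : ℕ) / X ^ 2) *
        extCount (degreeFamily d) H := by
  have hcount : ((residualDeg d H j * residualDeg d H k * extCount (degreeFamily d) H : ℕ) : ℝ) ≤
    _ := Nat.cast_le.2 (residualDeg_mul_extCount_le hjk hH)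
  have hblocked := sum_card_blockedPairs_mul_sq_le hΔ hjk hX0.le hX
  rw [← le_div_iff₀ (by positivity)] at hblocked
  push_cast at hcount hblocked ⊢
  refine hcount.trans (add_le_add_right (hblocked.trans (le_of_eq ?_)) _)
  ring

end ConditionalEdgeProbability

section Existence

variable {V : Type*} [DecidableEq V] {d : V → ℕ} {G : Finset (Sym2 V)}

/-- The graph `G` has no loops and its degrees do not exceed `d`. -/
structure IsPartialRealization (d : V → ℕ) (G : Finset (Sym2 V)) : Prop where
  not_isDiag : ∀ e ∈ G, ¬ e.IsDiag
  edgeDeg_le : ∀ v, edgeDeg G v ≤ d v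

namespace IsPartialRealization

theorem exists_card_eq_succ_of_notMem (hG : IsPartialRealization d G) {u v : V} (huv : u ≠ v)
    (hmem : s(u, v) ∉ G) (hu : edgeDeg G u < d u) (hv : edgeDeg G v < d v) :
    ∃ G', IsPartialRealization d G' ∧ G'.card = G.card + 1 := by
  refine ⟨insert s(u, v) G, ⟨fun e he => ?_, fun w => ?_⟩, Finset.card_insert_of_notMem hmem⟩
  · rcases Finset.mem_insert.1 he with rfl | he
    exacts [huv, hG.not_isDiag e he]
  · rw [edgeDeg_insert hmem, indicator_mem_mk huv]
    have := hG.edgeDeg_le w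
    split_ifs <;> grind

variable [Fintype V] {Δ : ℕ}

theorem exists_deficient_pair (hG : IsPartialRealization d G) (heven : Even (∑ v, d v))
    (hne : ∃ v, edgeDeg G v < d v) :
    ∃ u v, ∀ w, edgeDeg G w + ((if w = u then 1 else 0) + if w = v then 1 else 0) ≤ d w := by
  obtain ⟨u, hu⟩ := hne
  by_cases hv : ∃ v, v ≠ u ∧ edgeDeg G v < d v
  · obtain ⟨v, hvu, hv⟩ := hv
    refine ⟨u, v, fun w => ?_⟩
    have := hG.edgeDeg_le w
    split_ifs <;> grind
  · push Not at hv
    have herase : ∑ v ∈ Finset.univ.erase u, d v = ∑ v ∈ Finset.univ.erase u, edgeDeg G v :=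
      Finset.sum_congr rfl fun v hvu =>
        (hv v (Finset.ne_of_mem_erase hvu)).antisymm (hG.edgeDeg_le v)
    have hsum : ∑ v, d v = ∑ v, edgeDeg G v + (d u - edgeDeg G u) := by
      rw [← Finset.add_sum_erase _ _ (Finset.mem_univ u),
        ← Finset.add_sum_erase _ (fun v => edgeDeg G v) (Finset.mem_univ u), herase]
      omega
    rw [sum_edgeDeg_eq_two_mul_card hG.not_isDiag] at hsum
    refine ⟨u, u, fun w => ?_⟩
    have := hG.edgeDeg_le w
    obtain ⟨r, hr⟩ := heven
    split_ifs with hwu <;> subst_vars <;> omega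

theorem exists_card_eq_succ_of_lt_sum_edgeDeg (hG : IsPartialRealization d G)
    (hΔ : ∀ v, d v ≤ Δ) (hlarge : 2 * (Δ * (Δ + 1)) < ∑ v, edgeDeg G v) {u v : V}
    (huv : ∀ w, edgeDeg G w + ((if w = u then 1 else 0) + if w = v then 1 else 0) ≤ d w) :
    ∃ G', IsPartialRealization d G' ∧ G'.card = G.card + 1 := by
  have hcount := sum_edgeDeg_le_card_reroutable (subset_refl G)
    (fun v => (hG.edgeDeg_le v).trans (hΔ v)) u v
  obtain ⟨⟨a, b⟩, hab⟩ : (reroutable G G u v).Nonempty := Finset.card_pos.1 (by omega)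
  have hreroute : CanReroute G u v a b := (Finset.mem_filter.1 hab).2.2
  refine ⟨reroute G u v a b, ⟨hreroute.not_isDiag_of_mem_reroute hG.not_isDiag, fun w => ?_⟩,
    hreroute.card_reroute hG.not_isDiag⟩
  rw [hreroute.edgeDeg_reroute hG.not_isDiag]
  exact huv w

theorem exists_card_eq_succ_of_sum_edgeDeg_le (hG : IsPartialRealization d G)
    (hΔ : ∀ v, d v ≤ Δ) (hsum : 3 * (Δ * (Δ + 1)) < ∑ v, d v)
    (hsmall : ∑ v, edgeDeg G v ≤ 2 * (Δ * (Δ + 1))) (hne : ∃ v, edgeDeg G v < d v) :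
    ∃ G', IsPartialRealization d G' ∧ G'.card = G.card + 1 := by
  obtain ⟨u, hu⟩ := hne
  let deficient : Finset V := {v | edgeDeg G v < d v}
  have hdeficient : ∑ v, d v ≤ ∑ v, edgeDeg G v + deficient.card * Δ := by
    rw [← smul_eq_mul, ← Finset.sum_const, Finset.sum_filter, ← Finset.sum_add_distrib]
    refine Finset.sum_le_sum fun v _ => ?_
    have := hΔ v
    split_ifs <;> omega
  have hcard : (insert u ({a | s(u, a) ∈ G} : Finset V)).card < deficient.card := by
    refine (card_insert_filter_mk_mem_le ((hG.edgeDeg_le u).trans (hΔ u))).trans_lt ?_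
    by_contra! hle
    have := Nat.mul_le_mul_right Δ hle
    linarith
  obtain ⟨v, hv, hvu⟩ := Finset.exists_mem_notMem_of_card_lt_card hcard
  simp only [deficient, Finset.mem_filter, Finset.mem_univ, true_and, Finset.mem_insert,
    not_or] at hv hvu
  exact hG.exists_card_eq_succ_of_notMem (Ne.symm hvu.1) hvu.2 hu hv

end IsPartialRealization

theorem degreeFamily_nonempty [Fintype V] {Δ : ℕ} (hΔ : ∀ v, d v ≤ Δ) (heven : Even (∑ v, d v))
    (hsum : 3 * (Δ * (Δ + 1)) < ∑ v, d v) : (degreeFamily d).Nonempty := by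
  classical
  obtain ⟨G, hG, hmax⟩ := Finset.exists_max_image
    ({G | IsPartialRealization d G} : Finset (Finset (Sym2 V))) Finset.card
    ⟨∅, Finset.mem_filter.2 ⟨Finset.mem_univ _, by simp, by simp [edgeDeg]⟩⟩
  simp only [Finset.mem_filter, Finset.mem_univ, true_and] at hG hmax
  by_contra hempty
  have hne : ∃ v, edgeDeg G v < d v := by
    by_contra! hge
    exact hempty ⟨G, mem_degreeFamily.2
      ⟨hG.not_isDiag, fun v => (hG.edgeDeg_le v).antisymm (hge v)⟩⟩
  obtain ⟨G', hG', hcard⟩ : ∃ G', IsPartialRealization d G' ∧ G'.card = G.card + 1 := by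
    rcases le_or_gt (∑ v, edgeDeg G v) (2 * (Δ * (Δ + 1))) with hsmall | hlarge
    · exact hG.exists_card_eq_succ_of_sum_edgeDeg_le hΔ hsum hsmall hne
    · obtain ⟨u, v, huv⟩ := hG.exists_deficient_pair heven hne
      exact hG.exists_card_eq_succ_of_lt_sum_edgeDeg hΔ hlarge huv
  have := hmax G' hG'
  omega

end Existence

section TypicalDegrees

theorem sum_le_sum_sum_of_forall_exists_mem {X ι : Type*} [Fintype ι] {s : Finset X}
    {t : ι → Finset X} {w : X → ℝ} (hw : ∀ x, 0 ≤ w x) (hs : ∀ x ∈ s, ∃ i, x ∈ t i) :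
    ∑ x ∈ s, w x ≤ ∑ i, ∑ x ∈ t i, w x := by
  classical
  calc ∑ x ∈ s, w x
      ≤ ∑ x ∈ s, ∑ i, if x ∈ t i then w x else 0 := by
        refine Finset.sum_le_sum fun x hx => ?_
        obtain ⟨i, hi⟩ := hs x hx
        simpa only [if_pos hi] using Finset.single_le_sum
          (f := fun i => if x ∈ t i then w x else 0)
          (fun i _ => ite_nonneg (hw x) le_rfl) (Finset.mem_univ i)
    _ = ∑ i, ∑ x ∈ s ∩ t i, w x := by
        rw [Finset.sum_comm]
        simp only [Finset.sum_ite_mem]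
    _ ≤ ∑ i, ∑ x ∈ t i, w x :=
        Finset.sum_le_sum fun i _ => Finset.sum_le_sum_of_subset_of_nonneg
          Finset.inter_subset_right fun x _ _ => hw x

variable {V : Type*} [Fintype V] [DecidableEq V] {d : V → ℕ} {κ t : ℝ}

/-- The degrees of `H` are a `t`-fraction of those prescribed by `d`, up to a relative error `κ`:
the typicality condition on a partially revealed graph. -/
def HasFraction (d : V → ℕ) (κ t : ℝ) (H : Finset (Sym2 V)) : Prop :=
  ∀ v, |(edgeDeg H v : ℝ) - t * d v| ≤ κ * d v

theorem sum_productWeight_edgeDeg_deviation_le {G : Finset (Sym2 V)} (hG : G ∈ degreeFamily d)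
    (ht0 : 0 ≤ t) (ht1 : t ≤ 1) (hκ0 : 0 ≤ κ) (hκ2 : κ ≤ 2) {σ : ℝ} (hσ : σ ^ 2 = 1) (v : V) :
    ∑ H with κ * d v < σ * ((edgeDeg H v : ℝ) - t * d v), productWeight (thinning t G) H ≤
      Real.exp (-(κ ^ 2 / 4 * d v)) := by
  let A : Finset (Sym2 V) := {e | v ∈ e}
  have hA (H : Finset (Sym2 V)) : (H ∩ A).card = edgeDeg H v := by
    simp only [A, edgeDeg, Finset.inter_filter, Finset.inter_univ]
  have hmean : ∑ e ∈ A, thinning t G e = t * d v := by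
    rw [← (mem_degreeFamily.1 hG).2, ← hA]
    simp only [thinning, Finset.sum_ite_mem, Finset.sum_const, nsmul_eq_mul, mul_comm t,
      Finset.inter_comm G]
  have hle : ∑ e ∈ A, thinning t G e ≤ d v := by
    rw [hmean]
    exact mul_le_of_le_one_left (Nat.cast_nonneg _) ht1
  simpa only [hA, hmean] using sum_productWeight_deviation_le (thinning_nonneg ht0 G)
    (thinning_le_one ht1 G) A hle hκ0 hκ2 hσ

theorem sum_productWeight_not_hasFraction_le {G : Finset (Sym2 V)} (hG : G ∈ degreeFamily d)
    (ht0 : 0 ≤ t) (ht1 : t ≤ 1) (hκ0 : 0 ≤ κ) (hκ2 : κ ≤ 2) {δ : ℝ} (hδ : ∀ v, δ ≤ d v)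
    [DecidablePred (HasFraction d κ t)] :
    ∑ H with ¬ HasFraction d κ t H, productWeight (thinning t G) H ≤
      2 * Fintype.card V * Real.exp (-(κ ^ 2 / 4 * δ)) := by
  let deviating (p : V × ℤˣ) : Finset (Finset (Sym2 V)) :=
    {H | κ * d p.1 < (p.2 : ℤ) * ((edgeDeg H p.1 : ℝ) - t * d p.1)}
  have hcover : ∀ H ∈ ({H | ¬ HasFraction d κ t H} : Finset (Finset (Sym2 V))),
      ∃ p, H ∈ deviating p := by
    intro H hH
    simp only [HasFraction, not_forall, not_le, lt_abs, Finset.mem_filter, Finset.mem_univ,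
      true_and] at hH
    obtain ⟨v, hv | hv⟩ := hH
    · exact ⟨(v, 1), by simpa [deviating] using hv⟩
    · exact ⟨(v, -1), by simpa [deviating] using hv⟩
  have htail (p : V × ℤˣ) :
      ∑ H ∈ deviating p, productWeight (thinning t G) H ≤ Real.exp (-(κ ^ 2 / 4 * δ)) :=
    (sum_productWeight_edgeDeg_deviation_le hG ht0 ht1 hκ0 hκ2
      (by norm_cast; simp) p.1).trans <|
      Real.exp_le_exp.2 <| neg_le_neg <| mul_le_mul_of_nonneg_left (hδ p.1) (by positivity)
  calc ∑ H with ¬ HasFraction d κ t H, productWeight (thinning t G) H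
      ≤ ∑ p, ∑ H ∈ deviating p, productWeight (thinning t G) H :=
        sum_le_sum_sum_of_forall_exists_mem
          (productWeight_thinning_nonneg ht0 ht1 G) hcover
    _ ≤ ∑ _p : V × ℤˣ, Real.exp (-(κ ^ 2 / 4 * δ)) := Finset.sum_le_sum fun p _ => htail p
    _ = 2 * Fintype.card V * Real.exp (-(κ ^ 2 / 4 * δ)) := by
        rw [Finset.sum_const, Finset.card_univ, Fintype.card_prod, Fintype.card_units_int,
          nsmul_eq_mul, Nat.cast_mul, Nat.cast_two, mul_comm (Fintype.card V : ℝ)]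

namespace HasFraction

variable {H : Finset (Sym2 V)}

omit [Fintype V] in
theorem empty (d : V → ℕ) (hκ : 0 ≤ κ) : HasFraction d κ 0 ∅ := by
  intro v
  simp only [edgeDeg, Finset.filter_empty, Finset.card_empty, Nat.cast_zero, zero_mul, sub_zero,
    abs_zero]
  positivity

omit [Fintype V] in
theorem abs_residualDeg_sub_le (hH : HasFraction d κ t H) (hκ : κ ≤ 1 - t) (v : V) :
    |(residualDeg d H v : ℝ) - (1 - t) * d v| ≤ κ * d v := by
  have hscaled := mul_le_mul_of_nonneg_right hκ (Nat.cast_nonneg (α := ℝ) (d v))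
  have hdeg : edgeDeg H v ≤ d v := by
    have := (abs_le.1 (hH v)).2
    exact_mod_cast (by linarith : (edgeDeg H v : ℝ) ≤ d v)
  rw [residualDeg, Nat.cast_sub hdeg, abs_sub_comm]
  convert hH v using 2
  ring

theorem abs_sum_residualDeg_sub_le (hH : HasFraction d κ t H) (hκ : κ ≤ 1 - t) :
    |((∑ v, residualDeg d H v : ℕ) : ℝ) - (1 - t) * (∑ v, d v : ℕ)| ≤ κ * (∑ v, d v : ℕ) := by
  rw [Nat.cast_sum, Nat.cast_sum, Finset.mul_sum, Finset.mul_sum, ← Finset.sum_sub_distrib]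
  exact (Finset.abs_sum_le_sum_abs _ _).trans
    (Finset.sum_le_sum fun v _ => hH.abs_residualDeg_sub_le hκ v)

end HasFraction

end TypicalDegrees

section ModerateDegrees

variable {V : Type*} [Fintype V] {d : V → ℕ} {Δ : ℕ} {γ : ℝ}

/-- A quantitative form of the hypotheses on `d`: up to constants, `γ` measures how small
`Δ ^ 2 / ∑ v, d v` and the reciprocals of the degrees are. It is the relative error of all
estimates of edge probabilities below. -/
structure IsModerate (d : V → ℕ) (Δ : ℕ) (γ : ℝ) : Prop where
  pos : 0 < γ
  le_half : γ ≤ 1 / 2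
  one_le : 1 ≤ Δ
  deg_le : ∀ v, d v ≤ Δ
  le_deg : ∀ v, 20 ≤ γ ^ 2 * d v
  sq_le : 200 * (Δ : ℝ) ^ 2 ≤ γ ^ 3 * (∑ v, d v : ℕ)
  even : Even (∑ v, d v)

namespace IsModerate

theorem sum_pos (h : IsModerate d Δ γ) : 0 < ((∑ v, d v : ℕ) : ℝ) := by
  have hΔ : (0 : ℝ) < Δ := by exact_mod_cast h.one_le
  exact pos_of_mul_pos_right ((by positivity : 0 < 200 * (Δ : ℝ) ^ 2).trans_le h.sq_le)
    (pow_nonneg h.pos.le 3)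

theorem sq_le_sq_mul_sum (h : IsModerate d Δ γ) :
    400 * (Δ : ℝ) ^ 2 ≤ γ ^ 2 * (∑ v, d v : ℕ) := by
  have := mul_le_mul_of_nonneg_left h.le_half (mul_nonneg (sq_nonneg γ) h.sum_pos.le)
  linarith [h.sq_le]

theorem switch_le (h : IsModerate d Δ γ) :
    2 * ((Δ : ℝ) * (Δ + 1)) + 4 ≤ γ * (∑ v, d v : ℕ) / 10 := by
  have hΔ : (1 : ℝ) ≤ Δ := by exact_mod_cast h.one_le
  have hsq := mul_le_mul_of_nonneg_left h.le_half (mul_pos h.pos h.sum_pos).le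
  nlinarith [h.sq_le_sq_mul_sum]

theorem blocked_error_le (h : IsModerate d Δ γ) :
    (Δ : ℝ) ^ 2 * (∑ v, d v : ℕ) / (γ * (∑ v, d v : ℕ) / 4) ^ 2 ≤ γ / 10 := by
  have hM := h.sum_pos
  have hγ := h.pos
  rw [div_le_iff₀ (by positivity)]
  have hsq := mul_le_mul_of_nonneg_right h.sq_le hM.le
  have : 0 ≤ γ ^ 3 * ((∑ v, d v : ℕ) : ℝ) ^ 2 := by positivity
  linarith

variable [DecidableEq V]

theorem nonempty (h : IsModerate d Δ γ) : (degreeFamily d).Nonempty := by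
  refine degreeFamily_nonempty h.deg_le h.even ?_
  have hγ := mul_le_mul_of_nonneg_right h.le_half h.sum_pos.le
  have : (3 * ((Δ : ℝ) * (Δ + 1))) < (∑ v, d v : ℕ) := by linarith [h.switch_le, h.sum_pos]
  exact_mod_cast this

section Residual

variable {t : ℝ} {H : Finset (Sym2 V)}

theorem abs_residualDeg_sub_le (h : IsModerate d Δ γ) (ht : t ≤ 1 - γ)
    (hH : HasFraction d (γ ^ 2 / 10) t H) (v : V) :
    |(residualDeg d H v : ℝ) - (1 - t) * d v| ≤ γ / 10 * ((1 - t) * d v) := by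
  have hκ : γ ^ 2 / 10 ≤ γ / 10 * (1 - t) := by nlinarith [h.pos]
  refine (hH.abs_residualDeg_sub_le (by nlinarith [h.pos, h.le_half]) v).trans ?_
  rw [← mul_assoc]
  exact mul_le_mul_of_nonneg_right hκ (Nat.cast_nonneg _)

theorem abs_sum_residualDeg_sub_le (h : IsModerate d Δ γ) (ht : t ≤ 1 - γ)
    (hH : HasFraction d (γ ^ 2 / 10) t H) :
    |((∑ v, residualDeg d H v : ℕ) : ℝ) - (1 - t) * (∑ v, d v : ℕ)| ≤
      γ / 10 * ((1 - t) * (∑ v, d v : ℕ)) := by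
  have hκ : γ ^ 2 / 10 ≤ γ / 10 * (1 - t) := by nlinarith [h.pos]
  refine (hH.abs_sum_residualDeg_sub_le (by nlinarith [h.pos, h.le_half])).trans ?_
  rw [← mul_assoc]
  exact mul_le_mul_of_nonneg_right hκ (Nat.cast_nonneg _)

theorem add_switch_le_sum_residualDeg (h : IsModerate d Δ γ) (ht : t ≤ 1 - γ)
    (hH : HasFraction d (γ ^ 2 / 10) t H) :
    γ * (∑ v, d v : ℕ) / 4 + 2 * ((Δ : ℝ) * (Δ + 1)) + 4 ≤ (∑ v, residualDeg d H v : ℕ) := by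
  have hlower := (abs_le.1 (h.abs_sum_residualDeg_sub_le ht hH)).1
  have hfraction : γ * (9 / 10) * (∑ v, d v : ℕ) ≤ (1 - t) * (1 - γ / 10) * (∑ v, d v : ℕ) :=
    mul_le_mul_of_nonneg_right
      (mul_le_mul (by linarith) (by linarith [h.le_half]) (by norm_num) (by linarith [h.pos]))
      h.sum_pos.le
  linarith [h.switch_le, mul_pos h.pos h.sum_pos]

theorem residualDeg_mul_residualDeg_le (h : IsModerate d Δ γ) (ht : t ≤ 1 - γ) (j k : V) :
    (residualDeg d H j : ℝ) * residualDeg d H k ≤ γ / 10 * ((1 - t) * (∑ v, d v : ℕ)) := by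
  have hle (v : V) : (residualDeg d H v : ℝ) ≤ Δ :=
    Nat.cast_le.2 ((Nat.sub_le _ _).trans (h.deg_le v))
  have hfraction := mul_le_mul_of_nonneg_right (by nlinarith [h.pos] : γ ^ 2 ≤ γ * (1 - t))
    h.sum_pos.le
  calc (residualDeg d H j : ℝ) * residualDeg d H k
      ≤ Δ * Δ := mul_le_mul (hle j) (hle k) (Nat.cast_nonneg _) (Nat.cast_nonneg _)
    _ ≤ γ / 10 * ((1 - t) * (∑ v, d v : ℕ)) := by
        linarith [h.sq_le_sq_mul_sum, mul_pos (pow_pos h.pos 2) h.sum_pos]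

theorem one_le_mul_residualDeg (h : IsModerate d Δ γ) (ht : t ≤ 1 - γ)
    (hH : HasFraction d (γ ^ 2 / 10) t H) (v : V) : 1 ≤ γ / 10 * residualDeg d H v := by
  have hlower := (abs_le.1 (h.abs_residualDeg_sub_le ht hH v)).1
  have hfraction : γ * (1 / 2) * d v ≤ (1 - t) * (1 - γ / 10) * d v :=
    mul_le_mul_of_nonneg_right
      (mul_le_mul (by linarith) (by linarith [h.le_half]) (by norm_num) (by linarith [h.pos]))
      (Nat.cast_nonneg _)
  nlinarith [h.le_deg v, h.pos]

theorem residualDeg_mul_extCount_le (h : IsModerate d Δ γ) (ht : t ≤ 1 - γ)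
    (hH : HasFraction d (γ ^ 2 / 10) t H) {j k : V} (hjk : j ≠ k) (hjkH : s(j, k) ∉ H) :
    residualDeg d H j * residualDeg d H k * (1 - γ / 5) * extCount (degreeFamily d) H ≤
      (1 - t) * (1 + γ / 5) * (∑ v, d v : ℕ) *
        extCount (degreeFamily d) (insert s(j, k) H) := by
  have hM := h.sum_pos
  have hγ := h.pos
  have hswitch := residualDeg_mul_le_extCount_insert h.deg_le hjk hjkH (by positivity)
    (h.add_switch_le_sum_residualDeg ht hH)
  have hN : (0 : ℝ) ≤ extCount (degreeFamily d) H := Nat.cast_nonneg _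
  have hloop := mul_le_mul_of_nonneg_left (h.one_le_mul_residualDeg ht hH k)
    (mul_nonneg (Nat.cast_nonneg (residualDeg d H j)) hN)
  have hblocked := mul_le_mul_of_nonneg_right (mul_le_mul_of_nonneg_left h.blocked_error_le
    (mul_nonneg (Nat.cast_nonneg (residualDeg d H j)) (Nat.cast_nonneg (residualDeg d H k)))) hN
  have htotal : ((∑ v, residualDeg d H v : ℕ) : ℝ) + residualDeg d H j * residualDeg d H k ≤
      (1 - t) * (1 + γ / 5) * (∑ v, d v : ℕ) := by
    linarith [h.residualDeg_mul_residualDeg_le (H := H) ht j k,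
      (abs_le.1 (h.abs_sum_residualDeg_sub_le ht hH)).2]
  have hinsert := mul_le_mul_of_nonneg_right htotal
    (Nat.cast_nonneg (α := ℝ) (extCount (degreeFamily d) (insert s(j, k) H)))
  linarith

theorem mul_extCount_le_extCount_insert (h : IsModerate d Δ γ) (ht : t ≤ 1 - γ)
    (hH : HasFraction d (γ ^ 2 / 10) t H) {j k : V} (hjk : j ≠ k) (hjkH : s(j, k) ∉ H) :
    (1 - t) * ((1 - γ) * (d j * d k / (∑ v, d v : ℕ))) * extCount (degreeFamily d) H ≤
      extCount (degreeFamily d) (insert s(j, k) H) := by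
  have hγ := h.pos
  have hγ2 := h.le_half
  have hM := h.sum_pos
  have ht0 : 0 < 1 - t := by linarith
  have hlower (v : V) : (1 - γ / 10) * ((1 - t) * d v) ≤ residualDeg d H v := by
    linarith [(abs_le.1 (h.abs_residualDeg_sub_le ht hH v)).1]
  have herror : (1 - γ) * (1 + γ / 5) ≤ (1 - γ / 10) ^ 2 * (1 - γ / 5) := by
    linarith [mul_le_mul_of_nonneg_left hγ2 (sq_nonneg γ), sq_nonneg γ]
  rw [← mul_le_mul_iff_of_pos_left (by positivity : 0 < (1 - t) * (1 + γ / 5) * (∑ v, d v : ℕ))]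
  calc (1 - t) * (1 + γ / 5) * (∑ v, d v : ℕ) *
        ((1 - t) * ((1 - γ) * (d j * d k / (∑ v, d v : ℕ))) * extCount (degreeFamily d) H)
      = (1 - γ) * (1 + γ / 5) *
          ((1 - t) ^ 2 * (d j * d k) * extCount (degreeFamily d) H) := by
        field_simp
    _ ≤ (1 - γ / 10) ^ 2 * (1 - γ / 5) *
          ((1 - t) ^ 2 * (d j * d k) * extCount (degreeFamily d) H) := by gcongr
    _ = (1 - γ / 10) * ((1 - t) * d j) * ((1 - γ / 10) * ((1 - t) * d k)) * (1 - γ / 5) *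
          extCount (degreeFamily d) H := by ring
    _ ≤ residualDeg d H j * residualDeg d H k * (1 - γ / 5) * extCount (degreeFamily d) H := by
        have hj := hlower j
        have hk := hlower k
        have : 0 ≤ 1 - γ / 10 := by linarith
        have : 0 ≤ 1 - γ / 5 := by linarith
        gcongr
    _ ≤ (1 - t) * (1 + γ / 5) * (∑ v, d v : ℕ) *
          extCount (degreeFamily d) (insert s(j, k) H) :=
        h.residualDeg_mul_extCount_le ht hH hjk hjkH

end Residual

theorem mul_card_le_extCount_singleton (h : IsModerate d Δ γ) {j k : V} (hjk : j ≠ k) :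
    (1 - γ) * (d j * d k / (∑ v, d v : ℕ)) * (degreeFamily d).card ≤
      extCount (degreeFamily d) {s(j, k)} := by
  simpa [extCount] using h.mul_extCount_le_extCount_insert (by linarith [h.le_half])
    (HasFraction.empty d (by positivity)) hjk (Finset.notMem_empty _)

theorem mul_extCount_singleton_le (h : IsModerate d Δ γ) (j k : V) :
    (1 - γ) * extCount (degreeFamily d) {s(j, k)} ≤
      (d j * d k / (∑ v, d v : ℕ) : ℝ) * (degreeFamily d).card := by
  have hresidual (v : V) : residualDeg d ∅ v = d v := by simp [residualDeg, edgeDeg]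
  have hswitch := extCount_insert_mul_le h.deg_le (Finset.notMem_empty s(j, k))
    (X := (1 - γ) * (∑ v, d v : ℕ)) (by
      simp only [hresidual]
      linarith [h.switch_le, mul_pos h.pos h.sum_pos])
  have hempty : extCount (degreeFamily d) ∅ = (degreeFamily d).card := by simp [extCount]
  rw [hempty, hresidual, hresidual, insert_empty_eq] at hswitch
  rw [div_mul_eq_mul_div, le_div_iff₀ h.sum_pos]
  linarith

end IsModerate

end ModerateDegrees

section DiscreteMeasure

variable {X Y : Type*} [Fintype X] [MeasurableSpace X]

/-- The measure with mass `w x` at each point `x`, for a nonnegative weight `w`; negative weights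
are truncated to `0`. -/
noncomputable def discreteMeasure (w : X → ℝ) : Measure X :=
  Measure.sum fun x => ENNReal.ofReal (w x) • Measure.dirac x

variable [DiscreteMeasurableSpace X]

open Classical in
theorem discreteMeasure_apply {w : X → ℝ} (hw : ∀ x, 0 ≤ w x) (S : Set X) :
    discreteMeasure w S = ENNReal.ofReal (∑ x with x ∈ S, w x) := by
  rw [discreteMeasure, Measure.sum_apply _ .of_discrete, tsum_fintype,
    ENNReal.ofReal_sum_of_nonneg fun x _ => hw x, Finset.sum_filter]
  refine Finset.sum_congr rfl fun x _ => ?_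
  by_cases hx : x ∈ S <;> simp [hx]

theorem isProbabilityMeasure_discreteMeasure {w : X → ℝ} (hw : ∀ x, 0 ≤ w x)
    (hsum : ∑ x, w x = 1) : IsProbabilityMeasure (discreteMeasure w) :=
  ⟨by simp [discreteMeasure_apply hw, hsum]⟩

theorem map_discreteMeasure [Finite Y] [MeasurableSpace Y] [DiscreteMeasurableSpace Y]
    [DecidableEq Y] {w : X → ℝ} (hw : ∀ x, 0 ≤ w x) (f : X → Y) :
    (discreteMeasure w).map f = discreteMeasure fun y => ∑ x with f x = y, w x := by
  classical
  have := Fintype.ofFinite Y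
  ext S hS
  rw [Measure.map_apply .of_discrete hS, discreteMeasure_apply hw,
    discreteMeasure_apply fun y => Finset.sum_nonneg fun x _ => hw x]
  congr 1
  rw [← Finset.sum_fiberwise_of_maps_to (t := {y | y ∈ S}) (g := f) (by simp)]
  refine Finset.sum_congr rfl fun y hy => Finset.sum_congr ?_ fun _ _ => rfl
  ext x
  simp only [Finset.mem_filter, Finset.mem_univ, true_and, Set.mem_preimage] at hy ⊢
  exact ⟨fun h => h.2, fun h => ⟨h ▸ hy, h⟩⟩

theorem isCoupling_discreteMeasure [Fintype Y] [MeasurableSpace Y] [DiscreteMeasurableSpace Y]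
    {J : X → Y → ℝ} {μ : X → ℝ} {ν : Y → ℝ} (hJ : ∀ x y, 0 ≤ J x y)
    (hμ : ∀ x, ∑ y, J x y = μ x) (hν : ∀ y, ∑ x, J x y = ν y) (hone : ∑ x, μ x = 1) :
    IsCoupling (discreteMeasure fun p : X × Y => J p.1 p.2) (discreteMeasure μ)
      (discreteMeasure ν) := by
  classical
  have hJ0 (p : X × Y) : 0 ≤ J p.1 p.2 := hJ _ _
  refine ⟨isProbabilityMeasure_discreteMeasure hJ0 ?_, ?_, ?_⟩
  · simp only [Fintype.sum_prod_type, hμ, hone]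
  · simp only [map_discreteMeasure hJ0, Finset.sum_filter, Fintype.sum_prod_type, hμ,
      Finset.sum_ite_irrel, Finset.sum_const_zero, Finset.sum_ite_eq', Finset.mem_univ, if_true]
  · simp only [map_discreteMeasure hJ0, Finset.sum_filter, Fintype.sum_prod_type_right, hν,
      Finset.sum_ite_irrel, Finset.sum_const_zero, Finset.sum_ite_eq', Finset.mem_univ, if_true]

variable [DecidableEq X]

/-- The weight of the uniform distribution on `s`. -/
noncomputable def uniformWeight (s : Finset X) (x : X) : ℝ :=
  if x ∈ s then (s.card : ℝ)⁻¹ else 0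

omit [Fintype X] [MeasurableSpace X] [DiscreteMeasurableSpace X] in
theorem uniformWeight_nonneg (s : Finset X) (x : X) : 0 ≤ uniformWeight s x :=
  ite_nonneg (inv_nonneg.2 (Nat.cast_nonneg _)) le_rfl

omit [Fintype X] [MeasurableSpace X] [DiscreteMeasurableSpace X] in
theorem sum_uniformWeight (s t : Finset X) :
    ∑ x ∈ t, uniformWeight s x = ((t ∩ s).card : ℝ) / s.card := by
  simp only [uniformWeight, Finset.sum_ite_mem, Finset.sum_const, nsmul_eq_mul, div_eq_mul_inv]

omit [Fintype X] in
theorem uniformOn_eq_discreteMeasure [Finite X] {s : Finset X} (hs : s.Nonempty) :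
    ProbabilityTheory.uniformOn (s : Set X) = discreteMeasure (uniformWeight s) := by
  classical
  have := Fintype.ofFinite X
  ext S -
  have hS : S = (({x | x ∈ S} : Finset X) : Set X) := by ext; simp
  rw [discreteMeasure_apply (uniformWeight_nonneg s), sum_uniformWeight,
    ENNReal.ofReal_div_of_pos (by exact_mod_cast hs.card_pos), ENNReal.ofReal_natCast,
    ENNReal.ofReal_natCast, Finset.inter_comm]
  nth_rw 1 [hS]
  exact ProbabilityTheory.uniformOn_apply_finset

end DiscreteMeasure

section EdgeSets

variable {V : Type*}

instance [Countable V] : MeasurableSingletonClass (SimpleGraph V) where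
  measurableSet_singleton G := by
    convert SimpleGraph.measurable_adj (MeasurableSet.singleton G.Adj)
    ext G'
    simp only [Set.mem_singleton_iff, Set.mem_preimage, SimpleGraph.adj_inj]

variable [Fintype V] [DecidableEq V]

open Classical in
theorem sum_edgeFinset {𝒞 : Finset (Finset (Sym2 V))} (h𝒞 : ∀ R ∈ 𝒞, ∀ e ∈ R, ¬ e.IsDiag)
    (φ : Finset (Sym2 V) → ℝ) :
    ∑ G : SimpleGraph V with G.edgeFinset ∈ 𝒞, φ G.edgeFinset = ∑ R ∈ 𝒞, φ R := by
  refine Finset.sum_nbij (fun G => G.edgeFinset) (fun G hG => (Finset.mem_filter.1 hG).2)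
    (fun G _ G' _ h => SimpleGraph.edgeFinset_inj.1 h) (fun R hR => ?_) fun _ _ => rfl
  let G := SimpleGraph.fromEdgeSet (R : Set (Sym2 V))
  have hedge [Fintype G.edgeSet] : G.edgeFinset = R := by
    ext e
    simpa [G] using h𝒞 R hR e
  exact ⟨G, by simpa [hedge] using hR, by simp only [hedge]⟩

open Classical in
theorem sum_productWeight_edgeFinset {p : Sym2 V → ℝ} (hp : ∀ e, e.IsDiag → p e = 0)
    (φ : SimpleGraph V → ℝ) :
    ∑ G : SimpleGraph V, productWeight p G.edgeFinset * φ G =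
      productMean p fun R => φ (SimpleGraph.fromEdgeSet (R : Set (Sym2 V))) := by
  have hloopless := sum_edgeFinset (𝒞 := {R | ∀ e ∈ R, ¬ e.IsDiag}) (by simp)
    fun R => productWeight p R * φ (SimpleGraph.fromEdgeSet (R : Set (Sym2 V)))
  have hloop : ∀ R, productWeight p R * φ (SimpleGraph.fromEdgeSet (R : Set (Sym2 V))) ≠ 0 →
      ∀ e ∈ R, ¬ e.IsDiag := fun R hR e he hdiag =>
    hR (by rw [productWeight_eq_zero he (hp e hdiag), zero_mul])
  rw [Finset.sum_filter_of_ne fun R _ => hloop R, Finset.filter_true_of_mem] at hloopless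
  · simpa only [productMean, SimpleGraph.coe_edgeFinset, SimpleGraph.fromEdgeSet_edgeSet]
      using hloopless
  · simpa using fun G : SimpleGraph V => fun e => G.not_isDiag_of_mem_edgeSet

open Classical in
theorem edgeFinset_mem_degreeFamily {d : V → ℕ} {G : SimpleGraph V} :
    G.edgeFinset ∈ degreeFamily d ↔ ∀ v, (G.neighborSet v).ncard = d v := by
  have hdegree (v : V) : edgeDeg G.edgeFinset v = (G.neighborSet v).ncard := by
    rw [← card_filter_mk_mem, Set.ncard_eq_toFinset_card']
    congr 1
    ext a
    simp
  simp only [mem_degreeFamily, hdegree, and_iff_right_iff_imp]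
  exact fun _ e he => G.not_isDiag_of_mem_edgeFinset he

end EdgeSets

section RandomGraphs

variable {n : ℕ}

open Classical in
theorem inhomogeneousWeight_eq_productWeight {W : Matrix (Fin n) (Fin n) ℝ}
    {p : Sym2 (Fin n) → ℝ} (hW : ∀ j k, W j k = p s(j, k)) (hp : ∀ e, e.IsDiag → p e = 0)
    (G : SimpleGraph (Fin n)) : inhomogeneousWeight W G = productWeight p G.edgeFinset := by
  let factor (e : Sym2 (Fin n)) : ℝ := if e ∈ G.edgeFinset then p e else 1 - p e
  have hpairs : ∏ e : Sym2 (Fin n) with ¬ e.IsDiag, factor e =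
      ∏ q : Fin n × Fin n with q.1 < q.2, factor s(q.1, q.2) := by
    have hlt : ({q | q.1 < q.2} : Finset (Fin n × Fin n)) =
        {q ∈ (Finset.univ : Finset (Fin n)).offDiag | q.1 < q.2} := by
      ext q
      simpa using LT.lt.ne
    rw [hlt, ← Finset.sym2_univ (α := Fin n)]
    exact Finset.sum_sym2_filter_not_isDiag (M := Additive ℝ) Finset.univ factor
  calc inhomogeneousWeight W G
      = ∏ j, ∏ k, if j < k then factor s(j, k) else 1 := by
        simp [inhomogeneousWeight, ← Finset.filter_lt_eq_Ioi, Finset.prod_filter, factor, hW]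
    _ = ∏ q : Fin n × Fin n with q.1 < q.2, factor s(q.1, q.2) := by
        rw [Finset.prod_filter, Fintype.prod_prod_type]
    _ = productWeight p G.edgeFinset := by
        rw [← hpairs, productWeight]
        refine Finset.prod_filter_of_ne fun e _ he hdiag => he ?_
        have : e ∉ G.edgeFinset := fun hmem => G.not_isDiag_of_mem_edgeFinset hmem hdiag
        simp only [factor, if_neg this, hp e hdiag, sub_zero]

variable {d : Fin n → ℕ}

open Classical in
theorem sum_graphsWithDegrees (d : Fin n → ℕ) (φ : SimpleGraph (Fin n) → ℝ) :
    ∑ G ∈ (graphsWithDegrees d).toFinset, φ G =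
      ∑ R ∈ degreeFamily d, φ (SimpleGraph.fromEdgeSet (R : Set (Sym2 (Fin n)))) := by
  rw [← sum_edgeFinset fun R hR => (mem_degreeFamily.1 hR).1]
  simp only [SimpleGraph.coe_edgeFinset, SimpleGraph.fromEdgeSet_edgeSet]
  refine Finset.sum_congr ?_ fun _ _ => rfl
  ext G
  rw [Set.mem_toFinset, Finset.mem_filter_univ, edgeFinset_mem_degreeFamily]
  rfl

open Classical in
theorem card_graphsWithDegrees (d : Fin n → ℕ) :
    (graphsWithDegrees d).toFinset.card = (degreeFamily d).card := by
  have h := sum_graphsWithDegrees d fun _ => 1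
  simp only [Finset.sum_const, nsmul_eq_mul, mul_one] at h
  exact_mod_cast h

open Classical in
theorem sum_uniformWeight_graphsWithDegrees (d : Fin n → ℕ) (U : Finset (SimpleGraph (Fin n))) :
    ∑ G ∈ U, uniformWeight (graphsWithDegrees d).toFinset G =
      (∑ R ∈ degreeFamily d,
        if SimpleGraph.fromEdgeSet (R : Set (Sym2 (Fin n))) ∈ U then (1 : ℝ) else 0) /
          (degreeFamily d).card := by
  rw [sum_uniformWeight, ← sum_graphsWithDegrees d fun G => if G ∈ U then 1 else 0,
    card_graphsWithDegrees, Finset.sum_boole, Finset.filter_mem_eq_inter, Finset.inter_comm]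

open Classical in
theorem degreeGraph_eq_discreteMeasure (hd : (degreeFamily d).Nonempty) :
    degreeGraph d = discreteMeasure (uniformWeight (graphsWithDegrees d).toFinset) := by
  rw [← uniformOn_eq_discreteMeasure, Set.coe_toFinset, degreeGraph]
  rwa [← Finset.card_pos, card_graphsWithDegrees, Finset.card_pos]

theorem degreeGraph_real_adj (hd : (degreeFamily d).Nonempty) {j k : Fin n} (hjk : j ≠ k) :
    (degreeGraph d).real {G | G.Adj j k} =
      (extCount (degreeFamily d) {s(j, k)} : ℝ) / (degreeFamily d).card := by
  classical
  rw [degreeGraph_eq_discreteMeasure hd, Measure.real,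
    discreteMeasure_apply (uniformWeight_nonneg _), ENNReal.toReal_ofReal
      (Finset.sum_nonneg fun G _ => uniformWeight_nonneg _ G),
    sum_uniformWeight_graphsWithDegrees, Finset.sum_boole]
  simp [extCount, hjk]

end RandomGraphs

section RealEstimates

variable {x γ : ℝ}

theorem mul_div_one_add_le_arrivalProb (hx : 0 ≤ x) (hxγ : x ≤ γ) (hγ : γ ≤ 1 / 2) :
    (1 - 3 * γ) * (x / (1 + x)) ≤ arrivalProb ((1 - γ) * x) (1 - γ) := by
  have hγ0 : 0 ≤ γ := hx.trans hxγ
  set z : ℝ := (1 - γ) * x * (1 - γ) with hz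
  have hz0 : 0 ≤ z := mul_nonneg (mul_nonneg (by linarith) hx) (by linarith)
  have hzx : z ≤ x := by
    rw [hz, mul_right_comm]
    exact mul_le_of_le_one_left hx (by nlinarith)
  have hexp := exp_sub_one_sub_le_sq (x := -z) (by rw [abs_neg, abs_of_nonneg hz0]; linarith)
  calc (1 - 3 * γ) * (x / (1 + x))
      ≤ (1 - γ) ^ 3 * (x / (1 + x)) := by
        gcongr
        nlinarith [pow_nonneg hγ0 2]
    _ ≤ (1 - γ) ^ 3 * x := by
        have : 0 ≤ 1 - γ := by linarith
        gcongr
        exact div_le_self hx (by linarith)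
    _ = z * (1 - γ) := by rw [hz]; ring
    _ ≤ z * (1 - z) := by gcongr; linarith
    _ ≤ arrivalProb ((1 - γ) * x) (1 - γ) := by
        rw [arrivalProb, ← hz]
        linarith

theorem arrivalProb_le_div_one_add (hx : 0 ≤ x) (hxγ : x ≤ γ) (hγ : γ ≤ 1 / 2) :
    arrivalProb ((1 - γ) * x) (1 - γ) ≤ x / (1 + x) := by
  have hcontract : (1 - γ) ^ 2 * (1 + x) ≤ 1 := by
    have hγ0 : 0 ≤ γ := hx.trans hxγ
    calc (1 - γ) ^ 2 * (1 + x) ≤ (1 - γ) ^ 2 * (1 + γ) := by gcongr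
      _ ≤ 1 := by nlinarith [mul_nonneg hγ0 (sq_nonneg γ)]
  calc arrivalProb ((1 - γ) * x) (1 - γ)
      ≤ (1 - γ) ^ 2 * x := by
        rw [arrivalProb]
        linarith [Real.add_one_le_exp (-((1 - γ) * x * (1 - γ)))]
    _ ≤ x / (1 + x) := by
        rw [le_div_iff₀ (by linarith)]
        linarith [mul_le_mul_of_nonneg_right hcontract hx]

theorem abs_sub_div_one_add_le {p : ℝ} (hx : 0 ≤ x) (hxγ : x ≤ γ) (hγ : γ ≤ 1 / 2)
    (hp : (1 - γ) * x ≤ p) (hp' : (1 - γ) * p ≤ x) :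
    |p - x / (1 + x)| ≤ 4 * γ * (x / (1 + x)) := by
  have hγ0 : 0 ≤ γ := hx.trans hxγ
  set P : ℝ := x / (1 + x)
  have hP0 : 0 ≤ P := by positivity
  have hPx : P * (1 + x) = x := div_mul_cancel₀ x (by positivity)
  have hPγ : 0 ≤ γ * P := mul_nonneg hγ0 hP0
  rw [abs_le]
  constructor
  · nlinarith [mul_le_mul_of_nonneg_left (div_le_self hx (by linarith) : P ≤ x)
      (by linarith : 0 ≤ 1 - γ)]
  · suffices p ≤ (1 + 4 * γ) * P by linarith
    refine le_of_mul_le_mul_left (a := 1 - γ) ?_ (by linarith)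
    calc (1 - γ) * p ≤ P * (1 + x) := hp'.trans_eq hPx.symm
      _ ≤ P * ((1 - γ) * (1 + 4 * γ)) := by gcongr; nlinarith
      _ = (1 - γ) * ((1 + 4 * γ) * P) := by ring

end RealEstimates

section Domination

variable {V : Type*} [Fintype V]

/-- The rate at which the pair `e` is added to the embedded graph: a slightly smaller multiple of
`d j * d k / ‖d‖₁` for `e = s(j, k)`, and `0` on loops. -/
noncomputable def edgeRate [DecidableEq V] (d : V → ℕ) (γ : ℝ) : Sym2 V → ℝ :=
  Sym2.lift ⟨fun j k => if j = k then 0 else (1 - γ) * (d j * d k / (∑ v, d v : ℕ)),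
    fun j k => by simp only [eq_comm (a := j), mul_comm (d j : ℝ)]⟩

section

variable [DecidableEq V] (d : V → ℕ) (γ : ℝ)

theorem edgeRate_mk {j k : V} (hjk : j ≠ k) :
    edgeRate d γ s(j, k) = (1 - γ) * (d j * d k / (∑ v, d v : ℕ)) :=
  if_neg hjk

theorem edgeRate_of_isDiag {e : Sym2 V} (he : e.IsDiag) : edgeRate d γ e = 0 := by
  induction e with | _ j k
  exact if_pos (Sym2.mk_isDiag_iff.1 he)

end

namespace IsModerate

variable {d : V → ℕ} {Δ : ℕ} {γ : ℝ}

theorem mul_div_sum_le (h : IsModerate d Δ γ) (j k : V) :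
    (d j * d k / (∑ v, d v : ℕ) : ℝ) ≤ γ := by
  have hM := h.sum_pos
  have hγ := h.pos
  rw [div_le_iff₀ hM]
  have hj : (d j : ℝ) ≤ Δ := by exact_mod_cast h.deg_le j
  have hk : (d k : ℝ) ≤ Δ := by exact_mod_cast h.deg_le k
  calc (d j * d k : ℝ) ≤ Δ * Δ := by gcongr
    _ ≤ γ ^ 2 * (∑ v, d v : ℕ) := by linarith [h.sq_le_sq_mul_sum, sq_nonneg (Δ : ℝ)]
    _ ≤ γ * (∑ v, d v : ℕ) := by
        gcongr
        nlinarith [h.le_half]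

variable [DecidableEq V]

theorem edgeRate_nonneg (h : IsModerate d Δ γ) (e : Sym2 V) : 0 ≤ edgeRate d γ e := by
  induction e with | _ j k
  exact ite_nonneg le_rfl (mul_nonneg (by linarith [h.le_half]) (by positivity))

theorem edgeRate_le_one (h : IsModerate d Δ γ) (e : Sym2 V) : edgeRate d γ e ≤ 1 := by
  induction e with | _ j k
  rcases eq_or_ne j k with rfl | hjk
  · exact (edgeRate_of_isDiag d γ (Sym2.mk_isDiag_iff.2 rfl)).trans_le zero_le_one
  · rw [edgeRate_mk d γ hjk]
    nlinarith [h.mul_div_sum_le j k, h.pos, h.le_half]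

theorem sum_edgeRate_le (h : IsModerate d Δ γ) :
    ∑ e, edgeRate d γ e ≤ (Fintype.card V : ℝ) ^ 2 := by
  have hcard : Fintype.card (Sym2 V) ≤ Fintype.card (V × V) :=
    Fintype.card_le_of_surjective _ Sym2.mk_surjective
  calc ∑ e, edgeRate d γ e ≤ Fintype.card (Sym2 V) := by
        simpa using Finset.sum_le_card_nsmul Finset.univ _ 1 fun e _ => h.edgeRate_le_one e
    _ ≤ (Fintype.card V : ℝ) ^ 2 := by
        rw [sq]
        exact_mod_cast hcard.trans_eq (Fintype.card_prod V V)

theorem arrivalProb_edgeRate_nonneg (h : IsModerate d Δ γ) (e : Sym2 V) :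
    0 ≤ arrivalProb (edgeRate d γ e) (1 - γ) :=
  arrivalProb_nonneg (h.edgeRate_nonneg e) (by linarith [h.le_half])

theorem card_mul_productMean_arrivalProb_le (h : IsModerate d Δ γ) {δ : ℝ} (hδ : ∀ v, δ ≤ d v)
    (herr : 2 * Fintype.card V * Real.exp (-((γ ^ 2 / 10) ^ 2 / 4 * δ)) *
      (Fintype.card V : ℝ) ^ 2 ≤ γ)
    {f : Finset (Sym2 V) → ℝ} (hf : Monotone f) (hf0 : ∀ S, 0 ≤ f S) (hf1 : ∀ S, f S ≤ 1) :
    (degreeFamily d).card * productMean (fun e => arrivalProb (edgeRate d γ e) (1 - γ)) f ≤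
      ∑ R ∈ degreeFamily d, f R + (degreeFamily d).card * γ := by
  classical
  have hγ := h.pos
  have hγ2 := h.le_half
  set β : ℝ := 2 * Fintype.card V * Real.exp (-((γ ^ 2 / 10) ^ 2 / 4 * δ))
  have hsized : (degreeFamily d : Set (Finset (Sym2 V))).Sized ((∑ v, d v) / 2) := by
    intro R hR
    obtain ⟨hloopless, hdeg⟩ := mem_degreeFamily.1 hR
    have := sum_edgeDeg_eq_two_mul_card hloopless
    simp only [hdeg] at this
    lia
  have hedge : ∀ t, 0 ≤ t → t ≤ 1 - γ → ∀ H, HasFraction d (γ ^ 2 / 10) t H → ∀ e, e ∉ H →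
      (1 - t) * edgeRate d γ e * extCount (degreeFamily d) H ≤
        extCount (degreeFamily d) (insert e H) := by
    intro t _ ht H hH e he
    induction e with | _ j k
    by_cases hjk : j = k
    · simp [edgeRate_of_isDiag d γ (Sym2.mk_isDiag_iff.2 hjk)]
    · rw [edgeRate_mk d γ hjk]
      exact h.mul_extCount_le_extCount_insert ht hH hjk he
  have hatypical : ∀ t, 0 ≤ t → t ≤ 1 - γ → ∀ G ∈ degreeFamily d,
      ∑ H with ¬ HasFraction d (γ ^ 2 / 10) t H, productWeight (thinning t G) H ≤ β :=
    fun t ht0 ht G hG => sum_productWeight_not_hasFraction_le hG ht0 (by linarith)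
      (by positivity) (by nlinarith) hδ
  refine (card_mul_productMean_le hsized h.edgeRate_nonneg (by linarith) (by linarith)
    (HasFraction d (γ ^ 2 / 10)) hedge hatypical hf hf0 hf1).trans ?_
  gcongr
  calc (1 - γ) * (β * ∑ e, edgeRate d γ e) ≤ 1 * (β * (Fintype.card V : ℝ) ^ 2) := by
        gcongr
        · exact mul_nonneg (by positivity) (Finset.sum_nonneg fun e _ => h.edgeRate_nonneg e)
        · linarith
        · exact h.sum_edgeRate_le
    _ ≤ γ := by rwa [one_mul]

end IsModerate

end Domination

section Embedding

variable {n : ℕ}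

/-- The matrix `W` of edge probabilities of the embedded graph, whose edges arrive independently
at the rates `edgeRate d γ` up to time `1 - γ`. -/
noncomputable def embeddingMatrix (d : Fin n → ℕ) (γ : ℝ) : Matrix (Fin n) (Fin n) ℝ :=
  Matrix.of fun j k => arrivalProb (edgeRate d γ s(j, k)) (1 - γ)

theorem embeddingMatrix_isSymm (d : Fin n → ℕ) (γ : ℝ) : (embeddingMatrix d γ).IsSymm :=
  Matrix.IsSymm.ext fun j k => by simp only [embeddingMatrix, Matrix.of_apply, Sym2.eq_swap]

open Classical in
theorem inhomogeneousWeight_embeddingMatrix (d : Fin n → ℕ) (γ : ℝ) (G : SimpleGraph (Fin n)) :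
    inhomogeneousWeight (embeddingMatrix d γ) G =
      productWeight (fun e => arrivalProb (edgeRate d γ e) (1 - γ)) G.edgeFinset := by
  refine inhomogeneousWeight_eq_productWeight (W := embeddingMatrix d γ)
    (p := fun e => arrivalProb (edgeRate d γ e) (1 - γ)) (fun _ _ => rfl) (fun e he => ?_) G
  simp [edgeRate_of_isDiag d γ he, arrivalProb]

theorem sum_inhomogeneousWeight_embeddingMatrix_mul (d : Fin n → ℕ) (γ : ℝ)
    (φ : SimpleGraph (Fin n) → ℝ) :
    ∑ G, inhomogeneousWeight (embeddingMatrix d γ) G * φ G =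
      productMean (fun e => arrivalProb (edgeRate d γ e) (1 - γ))
        fun R => φ (SimpleGraph.fromEdgeSet (R : Set (Sym2 (Fin n)))) := by
  simp only [inhomogeneousWeight_embeddingMatrix]
  exact sum_productWeight_edgeFinset
    (fun e he => by simp [edgeRate_of_isDiag d γ he, arrivalProb]) φ

theorem sum_inhomogeneousWeight_embeddingMatrix (d : Fin n → ℕ) (γ : ℝ) :
    ∑ G, inhomogeneousWeight (embeddingMatrix d γ) G = 1 := by
  simpa [productMean_const] using sum_inhomogeneousWeight_embeddingMatrix_mul d γ fun _ => 1

theorem edgeMatrix_eq_div_one_add {d : Fin n → ℕ} (hd : 0 < (total d : ℝ)) {j k : Fin n}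
    (hjk : j ≠ k) :
    edgeMatrix d j k = (d j * d k / total d : ℝ) / (1 + d j * d k / total d) := by
  simp only [edgeMatrix, Matrix.of_apply, if_neg hjk]
  field_simp

namespace IsModerate

variable {d : Fin n → ℕ} {Δ : ℕ} {γ : ℝ}

theorem embeddingMatrix_mem_Icc (h : IsModerate d Δ γ) (j k : Fin n) :
    embeddingMatrix d γ j k ∈ Set.Icc ((1 - 3 * γ) * edgeMatrix d j k) (edgeMatrix d j k) := by
  rcases eq_or_ne j k with rfl | hjk
  · simp [edgeMatrix, embeddingMatrix, edgeRate, arrivalProb]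
  · rw [edgeMatrix_eq_div_one_add h.sum_pos hjk, embeddingMatrix, Matrix.of_apply,
      edgeRate_mk d γ hjk]
    have hle := h.mul_div_sum_le j k
    exact ⟨mul_div_one_add_le_arrivalProb (by positivity) hle h.le_half,
      arrivalProb_le_div_one_add (by positivity) hle h.le_half⟩

open Classical in
theorem sum_inhomogeneousWeight_le (h : IsModerate d Δ γ) {δ : ℝ} (hδ : ∀ v, δ ≤ d v)
    (herr : 2 * n * Real.exp (-((γ ^ 2 / 10) ^ 2 / 4 * δ)) * (n : ℝ) ^ 2 ≤ γ)
    {U : Finset (SimpleGraph (Fin n))} (hU : IsUpperSet (U : Set (SimpleGraph (Fin n)))) :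
    ∑ G ∈ U, inhomogeneousWeight (embeddingMatrix d γ) G ≤
      ∑ G ∈ U, uniformWeight (graphsWithDegrees d).toFinset G + γ := by
  let f (R : Finset (Sym2 (Fin n))) : ℝ :=
    if SimpleGraph.fromEdgeSet (R : Set (Sym2 (Fin n))) ∈ U then 1 else 0
  have hf : Monotone f := by
    intro R S hRS
    have hle := SimpleGraph.fromEdgeSet_mono (Finset.coe_subset.2 hRS)
    simp only [f]
    split_ifs with hR hS hS
    exacts [le_rfl, absurd (hU hle hR) hS, zero_le_one, le_rfl]
  have hf01 (R) : f R ∈ Set.Icc 0 1 := by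
    simp only [f]
    split_ifs <;> simp
  have hpos : 0 < ((degreeFamily d).card : ℝ) := by exact_mod_cast h.nonempty.card_pos
  have hdom := h.card_mul_productMean_arrivalProb_le hδ (by simpa using herr) hf
    (fun R => (hf01 R).1) fun R => (hf01 R).2
  have hsum := sum_inhomogeneousWeight_embeddingMatrix_mul d γ fun G => if G ∈ U then 1 else 0
  simp only [mul_ite, mul_one, mul_zero, Finset.sum_ite_mem, Finset.univ_inter] at hsum
  rw [hsum, sum_uniformWeight_graphsWithDegrees, ← sub_le_iff_le_add, le_div_iff₀ hpos]
  linarith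

theorem exists_coupling (h : IsModerate d Δ γ) {δ : ℝ} (hδ : ∀ v, δ ≤ d v)
    (herr : 2 * n * Real.exp (-((γ ^ 2 / 10) ^ 2 / 4 * δ)) * (n : ℝ) ^ 2 ≤ γ) :
    ∃ μ : Measure (SimpleGraph (Fin n) × SimpleGraph (Fin n)),
      IsCoupling μ (inhomogeneousGraph (embeddingMatrix d γ)) (degreeGraph d) ∧
      ENNReal.ofReal (1 - γ) ≤ μ {p | p.1 ≤ p.2} := by
  classical
  have hone := sum_inhomogeneousWeight_embeddingMatrix d γ
  have huniform : ∑ G, uniformWeight (graphsWithDegrees d).toFinset G = 1 := by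
    have hpos : ((degreeFamily d).card : ℝ) ≠ 0 := by exact_mod_cast h.nonempty.card_pos.ne'
    simp [sum_uniformWeight_graphsWithDegrees, hpos]
  obtain ⟨J, hJ, hfst, hsnd, hle⟩ := exists_coupling_of_sum_upperSet_le
    (fun G => (inhomogeneousWeight_embeddingMatrix d γ G).symm ▸ productWeight_nonneg
      h.arrivalProb_edgeRate_nonneg (fun e => arrivalProb_le_one _ _) _)
    (uniformWeight_nonneg _) (hone.trans huniform.symm)
    fun U hU => h.sum_inhomogeneousWeight_le hδ herr hU
  refine ⟨discreteMeasure fun p => J p.1 p.2, ?_, ?_⟩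
  · rw [degreeGraph_eq_discreteMeasure h.nonempty]
    exact isCoupling_discreteMeasure hJ hfst hsnd hone
  · rw [discreteMeasure_apply fun p => hJ _ _]
    refine ENNReal.ofReal_le_ofReal ?_
    rw [hone] at hle
    exact hle

theorem abs_degreeGraph_adj_sub_le (h : IsModerate d Δ γ) {j k : Fin n} (hjk : j ≠ k) :
    |(degreeGraph d).real {G | G.Adj j k} - edgeMatrix d j k| ≤ 4 * γ * edgeMatrix d j k := by
  have hpos : 0 < ((degreeFamily d).card : ℝ) := by exact_mod_cast h.nonempty.card_pos
  rw [degreeGraph_real_adj h.nonempty hjk, edgeMatrix_eq_div_one_add h.sum_pos hjk]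
  refine abs_sub_div_one_add_le (by positivity) (h.mul_div_sum_le j k) h.le_half ?_ ?_
  · rw [le_div_iff₀ hpos]
    exact h.mul_card_le_extCount_singleton hjk
  · rw [← mul_div_assoc, div_le_iff₀ hpos]
    exact h.mul_extCount_singleton_le j k

end IsModerate

end Embedding

section Asymptotics

theorem exists_tendsto_zero_of_forall_eventually {Q : ℝ → ℕ → Prop}
    (hmono : ∀ n a b, a ≤ b → Q a n → Q b n) (h : ∀ γ > 0, ∀ᶠ n in atTop, Q γ n) :
    ∃ ε : ℕ → ℝ, Tendsto ε atTop (𝓝 0) ∧ ∀ᶠ n in atTop, Q (ε n) n := by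
  let best (n : ℕ) : ℝ := sInf {γ | 0 < γ ∧ Q γ n}
  have hbdd (n) : BddBelow {γ | 0 < γ ∧ Q γ n} := ⟨0, fun γ hγ => hγ.1.le⟩
  have hbest0 (n) : 0 ≤ best n := Real.sInf_nonneg fun γ hγ => hγ.1.le
  refine ⟨fun n => best n + 1 / ((n : ℝ) + 1), ?_, ?_⟩
  · have hbest : Tendsto best atTop (𝓝 0) := by
      refine tendsto_order.2 ⟨fun a ha => .of_forall fun n => ha.trans_le (hbest0 n),
        fun a ha => ?_⟩
      filter_upwards [h (a / 2) (half_pos ha)] with n hn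
      exact (csInf_le (hbdd n) ⟨half_pos ha, hn⟩).trans_lt (half_lt_self ha)
    simpa using hbest.add tendsto_one_div_add_atTop_nhds_zero_nat
  · filter_upwards [h 1 one_pos] with n hn
    obtain ⟨γ, hγ, hlt⟩ := exists_lt_of_csInf_lt (s := {γ | 0 < γ ∧ Q γ n}) ⟨1, one_pos, hn⟩
      (lt_add_of_pos_right (best n) (by positivity : (0 : ℝ) < 1 / ((n : ℝ) + 1)))
    exact hmono n γ _ hlt.le hγ.2

section Logarithm

variable {m : ℕ → ℝ} (hm0 : ∀ n, 0 ≤ m n) (hm : (fun n : ℕ => Real.log n) =o[atTop] m)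
include hm0 hm

theorem tendsto_atTop_of_log_isLittleO : Tendsto m atTop atTop := by
  have hlog : Tendsto (fun n : ℕ => ‖Real.log n‖) atTop atTop :=
    tendsto_norm_atTop_atTop.comp (Real.tendsto_log_atTop.comp tendsto_natCast_atTop_atTop)
  simpa only [Real.norm_of_nonneg (hm0 _)] using hm.isBigO.trans_tendsto_norm_atTop hlog

theorem eventually_mul_exp_neg_mul_le {c γ : ℝ} (hc : 0 < c) (hγ : 0 < γ) :
    ∀ᶠ n : ℕ in atTop, 2 * n * Real.exp (-(c * m n)) * (n : ℝ) ^ 2 ≤ γ := by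
  filter_upwards [hm.bound (by positivity : 0 < c / 4), eventually_gt_atTop 0,
    tendsto_natCast_atTop_atTop.eventually_ge_atTop (2 / γ)] with n hlog hn hnγ
  have hn : (0 : ℝ) < n := by exact_mod_cast hn
  rw [Real.norm_of_nonneg (hm0 n)] at hlog
  have hexp : Real.exp (-(c * m n)) ≤ ((n : ℝ) ^ 4)⁻¹ := by
    rw [← Real.exp_log (pow_pos hn 4), ← Real.exp_neg, Real.exp_le_exp, Real.log_pow]
    push_cast
    linarith [Real.le_norm_self (Real.log n)]
  calc 2 * n * Real.exp (-(c * m n)) * (n : ℝ) ^ 2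
      ≤ 2 * n * ((n : ℝ) ^ 4)⁻¹ * (n : ℝ) ^ 2 := by gcongr
    _ = 2 / (n : ℝ) := by field_simp
    _ ≤ γ := by rwa [div_le_iff₀ hn, mul_comm, ← div_le_iff₀ hγ]

end Logarithm

theorem minDeg_le {n : ℕ} (d : Fin n → ℕ) (v : Fin n) : (minDeg d : ℝ) ≤ d v :=
  Nat.cast_le.2 (ciInf_le (OrderBot.bddBelow _) v)

theorem le_maxDeg {n : ℕ} (d : Fin n → ℕ) (v : Fin n) : d v ≤ maxDeg d :=
  Finset.le_sup (Finset.mem_univ v)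

theorem edgeMatrix_nonneg {n : ℕ} (d : Fin n → ℕ) (j k : Fin n) : 0 ≤ edgeMatrix d j k := by
  rw [edgeMatrix, Matrix.of_apply]
  exact ite_nonneg le_rfl (by positivity)

theorem edgeMatrix_le_one {n : ℕ} (d : Fin n → ℕ) (j k : Fin n) : edgeMatrix d j k ≤ 1 := by
  rw [edgeMatrix, Matrix.of_apply]
  split_ifs
  · exact zero_le_one
  · exact div_le_one_of_le₀ (le_add_of_nonneg_left (by positivity)) (by positivity)

/-- `W` is within a factor `1 - γ` below `P(d)`, and `μ` couples `𝒢(n, W)` and `𝒢(n, d)` so that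
the first graph is contained in the second with probability at least `1 - γ`. -/
structure IsEmbedding {n : ℕ} (d : Fin n → ℕ) (γ : ℝ) (W : Matrix (Fin n) (Fin n) ℝ)
    (μ : Measure (SimpleGraph (Fin n) × SimpleGraph (Fin n))) : Prop where
  isSymm : W.IsSymm
  nonneg : ∀ j k, 0 ≤ W j k
  le_edgeMatrix : ∀ j k, W j k ≤ edgeMatrix d j k
  mul_edgeMatrix_le : ∀ j k, (1 - γ) * edgeMatrix d j k ≤ W j k
  isCoupling : IsCoupling μ (inhomogeneousGraph W) (degreeGraph d)
  le_measure : ENNReal.ofReal (1 - γ) ≤ μ {p | p.1 ≤ p.2}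

theorem IsEmbedding.mono {n : ℕ} {d : Fin n → ℕ} {a b : ℝ} {W : Matrix (Fin n) (Fin n) ℝ}
    {μ : Measure (SimpleGraph (Fin n) × SimpleGraph (Fin n))} (h : IsEmbedding d a W μ)
    (hab : a ≤ b) : IsEmbedding d b W μ where
  __ := h
  mul_edgeMatrix_le j k := (mul_le_mul_of_nonneg_right (by linarith)
    (edgeMatrix_nonneg d j k)).trans (h.mul_edgeMatrix_le j k)
  le_measure := (ENNReal.ofReal_le_ofReal (by linarith)).trans h.le_measure

theorem IsModerate.exists_isEmbedding {n : ℕ} {d : Fin n → ℕ} {Δ : ℕ} {γ : ℝ}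
    (h : IsModerate d Δ γ)
    (herr : 2 * n * Real.exp (-((γ ^ 2 / 10) ^ 2 / 4 * minDeg d)) * (n : ℝ) ^ 2 ≤ γ) :
    ∃ W μ, IsEmbedding d (3 * γ) W μ := by
  obtain ⟨μ, hcoupling, hle⟩ := h.exists_coupling (minDeg_le d) herr
  exact ⟨embeddingMatrix d γ, μ,
    { isSymm := embeddingMatrix_isSymm d γ
      nonneg j k := h.arrivalProb_edgeRate_nonneg s(j, k)
      le_edgeMatrix j k := (h.embeddingMatrix_mem_Icc j k).2
      mul_edgeMatrix_le j k := (h.embeddingMatrix_mem_Icc j k).1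
      isCoupling := hcoupling
      le_measure := (ENNReal.ofReal_le_ofReal (by linarith [h.pos])).trans hle }⟩

variable {d : (n : ℕ) → Fin n → ℕ}

theorem tendsto_measure_of_isEmbedding {ε : ℕ → ℝ} (hε : Tendsto ε atTop (𝓝 0))
    {W : (n : ℕ) → Matrix (Fin n) (Fin n) ℝ}
    {μ : (n : ℕ) → Measure (SimpleGraph (Fin n) × SimpleGraph (Fin n))}
    (h : ∀ᶠ n in atTop, IsEmbedding (d n) (ε n) (W n) (μ n)) :
    Tendsto (fun n => μ n {p | p.1 ≤ p.2}) atTop (𝓝 1) := by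
  have hlower : Tendsto (fun n => ENNReal.ofReal (1 - ε n)) atTop (𝓝 1) := by
    simpa using ENNReal.tendsto_ofReal (hε.const_sub 1)
  refine tendsto_of_tendsto_of_tendsto_of_le_of_le' hlower tendsto_const_nhds
    (h.mono fun n hn => hn.le_measure) (h.mono fun n hn => ?_)
  have := hn.isCoupling.isProbabilityMeasure
  exact prob_le_one

section DegreeSequences

variable (heven : ∀ n, Even (total (d n)))
  (hmax : (fun n => (maxDeg (d n) : ℝ) ^ 2) =o[atTop] fun n => (total (d n) : ℝ))
include heven hmax

theorem eventually_isModerate (hmin : Tendsto (fun n => (minDeg (d n) : ℝ)) atTop atTop)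
    {γ : ℝ} (hγ : 0 < γ) (hγ2 : γ ≤ 1 / 2) :
    ∀ᶠ n in atTop, IsModerate (d n) (maxDeg (d n)) γ := by
  filter_upwards [hmax.bound (by positivity : 0 < γ ^ 3 / 200),
    hmin.eventually_ge_atTop (20 / γ ^ 2), eventually_gt_atTop 0] with n hsq hdeg hn
  rw [Real.norm_of_nonneg (by positivity), Real.norm_of_nonneg (by positivity)] at hsq
  have hle (v) : 20 / γ ^ 2 ≤ d n v := hdeg.trans (minDeg_le (d n) v)
  have hone : 0 < d n ⟨0, hn⟩ := by
    exact_mod_cast (by positivity : 0 < 20 / γ ^ 2).trans_le (hle ⟨0, hn⟩)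
  exact
    { pos := hγ
      le_half := hγ2
      one_le := hone.trans_le (le_maxDeg _ _)
      deg_le := le_maxDeg (d n)
      le_deg v := (div_le_iff₀' (by positivity)).1 (hle v)
      sq_le := by
        change _ ≤ γ ^ 3 * (total (d n) : ℝ)
        linarith
      even := heven n }

theorem exists_tendsto_zero_isEmbedding
    (hmin : (fun n : ℕ => Real.log n) =o[atTop] fun n => (minDeg (d n) : ℝ)) :
    ∃ ε : ℕ → ℝ, Tendsto ε atTop (𝓝 0) ∧
      ∀ᶠ n in atTop, ∃ W μ, IsEmbedding (d n) (ε n) W μ := by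
  have hnonneg (n : ℕ) : (0 : ℝ) ≤ minDeg (d n) := Nat.cast_nonneg _
  refine exists_tendsto_zero_of_forall_eventually (Q := fun γ n => ∃ W μ, IsEmbedding (d n) γ W μ)
    (fun n a b hab ⟨W, μ, h⟩ => ⟨W, μ, h.mono hab⟩) fun γ hγ => ?_
  have hγ' : 0 < min (γ / 3) (1 / 2) := by positivity
  filter_upwards [eventually_isModerate heven hmax (tendsto_atTop_of_log_isLittleO hnonneg hmin)
      hγ' (min_le_right _ _),
    eventually_mul_exp_neg_mul_le hnonneg hmin
      (by positivity : 0 < (min (γ / 3) (1 / 2) ^ 2 / 10) ^ 2 / 4) hγ'] with n hmoderate herr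
  obtain ⟨W, μ, h⟩ := hmoderate.exists_isEmbedding herr
  exact ⟨W, μ, h.mono (by linarith [min_le_left (γ / 3) (1 / 2)])⟩

theorem exists_tendsto_zero_abs_degreeGraph_adj_sub_le
    (hmin : Tendsto (fun n => (minDeg (d n) : ℝ)) atTop atTop) :
    ∃ η : ℕ → ℝ, Tendsto η atTop (𝓝 0) ∧
      ∀ᶠ n in atTop, ∀ j k, j ≠ k →
        |(degreeGraph (d n)).real {G | G.Adj j k} - edgeMatrix (d n) j k| ≤
          η n * edgeMatrix (d n) j k := by
  refine exists_tendsto_zero_of_forall_eventually (Q := fun γ n => ∀ j k, j ≠ k →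
    |(degreeGraph (d n)).real {G | G.Adj j k} - edgeMatrix (d n) j k| ≤
      γ * edgeMatrix (d n) j k) (fun n a b hab h j k hjk => ?_) fun γ hγ => ?_
  · exact (h j k hjk).trans (mul_le_mul_of_nonneg_right hab (edgeMatrix_nonneg _ _ _))
  · have hγ' : 0 < min (γ / 4) (1 / 2) := by positivity
    filter_upwards [eventually_isModerate heven hmax hmin hγ' (min_le_right _ _)] with n h j k hjk
    exact (h.abs_degreeGraph_adj_sub_le hjk).trans (mul_le_mul_of_nonneg_right
      (by linarith [min_le_left (γ / 4) (1 / 2)]) (edgeMatrix_nonneg _ _ _))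

end DegreeSequences

end Asymptotics

end RandomGraphEmbedding

theorem mainTheorem2
    (d : (n : ℕ) → Fin n → ℕ)
    (heven : ∀ n, Even (RandomGraphEmbedding.total (d n)))
    (hmax : (fun n => (RandomGraphEmbedding.maxDeg (d n) : ℝ) ^ 2)
      =o[atTop] fun n => (RandomGraphEmbedding.total (d n) : ℝ))
    (hmin : (fun n : ℕ => Real.log n)
      =o[atTop] fun n => (RandomGraphEmbedding.minDeg (d n) : ℝ)) :
    -- the embedding of `𝒢(n, W)` into `𝒢(n, d)`
    (∃ (W : (n : ℕ) → Matrix (Fin n) (Fin n) ℝ) (ε : ℕ → ℝ)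
        (μ : (n : ℕ) → Measure (SimpleGraph (Fin n) × SimpleGraph (Fin n))),
      Tendsto ε atTop (𝓝 0) ∧
      (∀ᶠ n in atTop,
        (W n).IsSymm ∧
        (∀ j k, 0 ≤ W n j k ∧ W n j k ≤ 1) ∧
        (∀ j k, (1 - ε n) * RandomGraphEmbedding.edgeMatrix (d n) j k ≤ W n j k ∧
          W n j k ≤ RandomGraphEmbedding.edgeMatrix (d n) j k) ∧
        RandomGraphEmbedding.IsCoupling (μ n)
          (RandomGraphEmbedding.inhomogeneousGraph (W n))
          (RandomGraphEmbedding.degreeGraph (d n))) ∧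
      Tendsto (fun n => μ n {p | p.1 ≤ p.2}) atTop (𝓝 1)) ∧
    -- its optimality: `P(d)` is uniformly asymptotic to the true edge probabilities
    (∃ η : ℕ → ℝ, Tendsto η atTop (𝓝 0) ∧
      ∀ᶠ n in atTop, ∀ j k, j ≠ k →
        |(RandomGraphEmbedding.degreeGraph (d n)).real {G | G.Adj j k} -
            RandomGraphEmbedding.edgeMatrix (d n) j k|
          ≤ η n * RandomGraphEmbedding.edgeMatrix (d n) j k) := by
  have hnonneg (n : ℕ) : (0 : ℝ) ≤ RandomGraphEmbedding.minDeg (d n) := Nat.cast_nonneg _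
  constructor
  · obtain ⟨ε, hε, hexists⟩ :=
      RandomGraphEmbedding.exists_tendsto_zero_isEmbedding heven hmax hmin
    obtain ⟨W, hW⟩ := skolem.1 hexists
    obtain ⟨μ, hμ⟩ := skolem.1 hW
    refine ⟨W, ε, μ, hε, hμ.mono fun n h => ⟨h.isSymm, fun j k => ⟨h.nonneg j k, ?_⟩,
      fun j k => ⟨h.mul_edgeMatrix_le j k, h.le_edgeMatrix j k⟩, h.isCoupling⟩,
      RandomGraphEmbedding.tendsto_measure_of_isEmbedding hε hμ⟩
    exact (h.le_edgeMatrix j k).trans (RandomGraphEmbedding.edgeMatrix_le_one _ j k)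
  · exact RandomGraphEmbedding.exists_tendsto_zero_abs_degreeGraph_adj_sub_le heven hmax
      (RandomGraphEmbedding.tendsto_atTop_of_log_isLittleO hnonneg hmin)
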